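/- Let $e_1=(1,0)$, $e_2=(0,1)$, $S_0=2\mathbb Z^2$, $S_1=e_1+2\mathbb Z^2$, $S_2=e_2+2\mathbb Z^2$ and $S=S_0\cup S_1\cup S_2$. Let $\mathcal J=\bigoplus_{\rho\in S}\mathbb C x^\rho$ be the Jordan algebra with $x^\rho\cdot x^\tau=x^{\rho+\tau}$ if $\rho+\tau\in S$ and $x^\rho\cdot x^\tau=0$ otherwise, and let $\langle\mathcal J,\mathcal J\rangle$ be the quotient of $\mathcal J\otimes\mathcal J$ by the span of all $a\otimes b+b\otimes a$ and $ab\otimes c+bc\otimes a+ca\otimes b$; write $\langle a,b\rangle$ for the class of $a\otimes b$ and $L_a$ for multiplication by $a$. The baby TKK algebra is the complex Lie algebra $\widehat{\mathcal G}(\mathcal J)=(\mathfrak{sl}_2\otimes\mathcal J)\oplus\langle\mathcal J,\mathcal J\rangle$ with $$[A\otimes a,B\otimes b]=[A,B]\otimes ab+2\,\mathrm{tr}(AB)\langle a,b\rangle,\qquad [\langle a,b\rangle,A\otimes c]=A\otimes[L_a,L_b]c,$$ $$[\langle a,b\rangle,\langle c,d\rangle]=\langle[L_a,L_b]c,d\rangle+\langle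 c,[L_a,L_b]d\rangle .$$ Let $x_+,x_-,\alpha^\vee$ be the standard basis of $\mathfrak{sl}_2$ (so $[x_+,x_-]=\alpha^\vee$, $[\alpha^\vee,x_\pm]=\pm2x_\pm$). For $\rho\in\mathbb Z^2$ let $x_\pm(\rho)=x_\pm\otimes x^\rho$ if $\rho\in S$ and $0$ otherwise; $\alpha^\vee(\rho)=\alpha^\vee\otimes x^\rho$ if $\rho\in S$ and $2\langle x^{e_1},x^{\rho-e_1}\rangle$ otherwise; $C_i(\rho)=\langle x^{e_i},x^{\rho-e_i}\rangle$ if $\rho\in S_0$ and $0$ otherwise ($i=1,2$); and $C_i=C_i(0)$. Let $d_1,d_2$ be the derivations of $\widehat{\mathcal G}(\mathcal J)$ with $d_i(A\otimes x^\rho)=\rho_i\,A\otimes x^\rho$ and $d_i\langle x^\rho,x^\tau\rangle=(\rho_i+\tau_i)\langle x^\rho,x^\tau\rangle$. Grade $\widehat{\mathcal G}(\mathcal J)$ by $\widehat{\mathcal G}(\mathcal J)_{(n)}=\{u: d_1u=-nu\}$, $n\in\mathbb Z$. Let $\mathfrak h$ be the span of $\alpha^\vee(0),C_1,C_2,d_1,d_2$,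 acting on $\widehat{\mathcal G}(\mathcal J)$ by the adjoint action and by the derivations $d_i$. Let $\alpha,\delta_1,\delta_2\in\mathfrak h^*$ be given by $\alpha(\alpha^\vee(0))=2$, $\delta_i(d_j)=\delta_{i,j}$ and zero on the other basis vectors, and for $\beta\in\mathfrak h^*$ let $\widehat{\mathcal G}(\mathcal J)_\beta$ be the space of the elements on which $\mathfrak h$ acts through $\beta$. Set $\Delta=\{\pm\alpha+m\delta_1+n\delta_2:(m,n)\in S\}\cup\{m\delta_1+n\delta_2:(m,n)\in\mathbb Z^2\}$, let $\Delta_+$ be the set of the elements of $\Delta$ of the form $\alpha+n\delta_2$, $\pm\alpha+m\delta_1+n\delta_2$ or $m\delta_1+n\delta_2$ with $m,n\in\mathbb Z$, $m>0$, and let $\Delta_0=\{n\delta_2:n\in\mathbb Z\}$. Put $\widehat{\mathcal G}(\mathcal J)^+=\bigoplus_{\beta\in\Delta_+}\widehat{\mathcal G}(\mathcal J)_\beta$ and $\mathcal H=\bigoplus_{\beta\in\Delta_0}\widehat{\mathcal G}(\mathcal J)_\beta$; note that $C_2\in\mathcal H$. A $\widehat{\mathcal G}(\mathcal J)$-module $W$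 is called *restricted* if for all $w\in W$, $n\in\mathbb Z$ and $s\in\mathbb Z\setminus\{0\}$ one has $x_\pm(m,n)w=0$, $\alpha^\vee(m,n)w=0$, $C_1(2m,2s)w=0$ and $C_2(2m,0)w=0$ whenever $m$ is sufficiently large; *integrable* if $x_\pm(m,n)$ acts locally nilpotently on $W$ for every $(m,n)\in S$; and *$\mathbb N$-graded* if $W=\bigoplus_{n\in\mathbb N}W_{(n)}$ with $\widehat{\mathcal G}(\mathcal J)_{(k)}W_{(n)}\subseteq W_{(n+k)}$ for all $k\in\mathbb Z$, $n\in\mathbb N$, where $W_{(j)}=0$ for $j<0$. **Proposition.** Let $W=\bigoplus_{n\in\mathbb N}W_{(n)}$ be an irreducible $\mathbb N$-graded integrable restricted $\widehat{\mathcal G}(\mathcal J)$-module. Then there are a nonzero vector $v\in W$ and a linear functional $\lambda\in\mathcal H^*$ such that $\widehat{\mathcal G}(\mathcal J)^+v=0$, $\lambda(C_2)=0$, and $hv=\lambda(h)v$ for all $h\in\mathcal H$. -/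

import Mathlib

noncomputable section

open scoped TensorProduct

set_option linter.unusedSectionVars false

namespace TKK

/-! ## The Tits-Kantor-Koecher construction of a commutative Jordan algebra over `ℂ` -/

section Construction

variable (J : Type*) [NonUnitalNonAssocCommRing J] [Module ℂ J] [IsScalarTower ℂ J J]
  [SMulCommClass ℂ J J]

/-- The Lie algebra of complex `2 × 2` matrices of trace zero. -/
abbrev Sl2 : Type := LieAlgebra.SpecialLinear.sl (Fin 2) ℂ

/-- The subspace of `J ⊗ J` spanned by the `a ⊗ b + b ⊗ a` and the `ab ⊗ c + bc ⊗ a + ca ⊗ b`. -/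
def pairingRel : Submodule ℂ (J ⊗[ℂ] J) :=
  Submodule.span ℂ
    ({t | ∃ a b : J, t = a ⊗ₜ[ℂ] b + b ⊗ₜ[ℂ] a} ∪
      {t | ∃ a b c : J, t = (a * b) ⊗ₜ[ℂ] c + (b * c) ⊗ₜ[ℂ] a + (c * a) ⊗ₜ[ℂ] b})

/-- The space `⟨J, J⟩`. -/
abbrev Pairing : Type _ := (J ⊗[ℂ] J) ⧸ pairingRel J

variable {J}

/-- The class `⟨a, b⟩` of `a ⊗ b`. -/
def pair : J →ₗ[ℂ] J →ₗ[ℂ] Pairing J :=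
  (TensorProduct.mk ℂ J J).compr₂ (pairingRel J).mkQ

theorem pair_def (a b : J) : pair a b = (pairingRel J).mkQ (a ⊗ₜ[ℂ] b) := rfl

theorem pair_swap (a b : J) : pair a b = -pair b a := by
  rw [eq_neg_iff_add_eq_zero, pair_def, pair_def, ← map_add, Submodule.mkQ_apply,
    Submodule.Quotient.mk_eq_zero]
  exact Submodule.subset_span (Or.inl ⟨a, b, rfl⟩)

theorem pair_cyclic (a b c : J) : pair (a * b) c + pair (b * c) a + pair (c * a) b = 0 := by
  simp only [pair_def]
  rw [← map_add, ← map_add, Submodule.mkQ_apply, Submodule.Quotient.mk_eq_zero]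
  exact Submodule.subset_span (Or.inr ⟨a, b, c, rfl⟩)

theorem pairing_induction {P : Pairing J → Prop} (p : Pairing J) (h0 : P 0)
    (hp : ∀ a b, P (pair a b)) (ha : ∀ p q, P p → P q → P (p + q)) : P p := by
  obtain ⟨t, rfl⟩ := (pairingRel J).mkQ_surjective p
  induction t using TensorProduct.induction_on with
  | zero => simpa using h0
  | tmul a b => exact hp a b
  | add x y hx hy => rw [map_add]; exact ha _ _ hx hy

theorem pairMap_aux (D : J →ₗ[ℂ] J) (hD : ∀ a b, D (a * b) = D a * b + a * D b) :
    pairingRel J ≤ LinearMap.ker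
      (TensorProduct.lift (pair.comp D + pair.compl₂ D) : J ⊗[ℂ] J →ₗ[ℂ] Pairing J) := by
  refine Submodule.span_le.mpr ?_
  rintro t (⟨a, b, rfl⟩ | ⟨a, b, c, rfl⟩)
  · simp only [SetLike.mem_coe, LinearMap.mem_ker, map_add, TensorProduct.lift.tmul,
      LinearMap.add_apply, LinearMap.comp_apply, LinearMap.compl₂_apply]
    rw [pair_swap (D a) b, pair_swap a (D b)]
    abel
  · simp only [SetLike.mem_coe, LinearMap.mem_ker, map_add, TensorProduct.lift.tmul,
      LinearMap.add_apply, LinearMap.comp_apply, LinearMap.compl₂_apply, hD]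
    linear_combination (norm := module)
      pair_cyclic (D a) b c + pair_cyclic a (D b) c + pair_cyclic a b (D c)

/-- The endomorphism of `⟨J, J⟩` induced by a derivation `D` of `J`:
`⟨a, b⟩ ↦ ⟨D a, b⟩ + ⟨a, D b⟩`. -/
def pairMap (D : J →ₗ[ℂ] J) (hD : ∀ a b, D (a * b) = D a * b + a * D b) :
    Pairing J →ₗ[ℂ] Pairing J :=
  (pairingRel J).liftQ (TensorProduct.lift (pair.comp D + pair.compl₂ D)) (pairMap_aux D hD)

@[simp] theorem pairMap_pair (D : J →ₗ[ℂ] J) (hD : ∀ a b, D (a * b) = D a * b + a * D b)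
    (a b : J) : pairMap D hD (pair a b) = pair (D a) b + pair a (D b) := rfl

/-- The inner derivation `[L_a, L_b] : c ↦ a (b c) - b (a c)`. -/
def innerDer : J →ₗ[ℂ] J →ₗ[ℂ] (J →ₗ[ℂ] J) :=
  LinearMap.mk₂ ℂ (fun a b => (LinearMap.mul ℂ J a).comp (LinearMap.mul ℂ J b) -
      (LinearMap.mul ℂ J b).comp (LinearMap.mul ℂ J a))
    (by intros; ext; simp [mul_add]; abel) (by intros; ext; simp [smul_sub])
    (by intros; ext; simp [mul_add]; abel) (by intros; ext; simp [smul_sub])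

@[simp] theorem innerDer_apply (a b c : J) : innerDer a b c = a * (b * c) - b * (a * c) := rfl

variable [IsCommJordan J]

theorem jordan_linearized (a b c d : J) :
    (a * ((b * c) * d) - (b * c) * (a * d)) + (b * ((c * a) * d) - (c * a) * (b * d)) +
      (c * ((a * b) * d) - (a * b) * (c * d)) = 0 := by
  have h := DFunLike.congr_fun (two_nsmul_lie_lmul_lmul_add_add_eq_zero a b c) d
  have h2 : (2 : ℂ) • ((a * ((b * c) * d) - (b * c) * (a * d)) +
      (b * ((c * a) * d) - (c * a) * (b * d)) + (c * ((a * b) * d) - (a * b) * (c * d))) = 0 := by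
    rw [ofNat_smul_eq_nsmul]
    exact h
  exact (smul_eq_zero.mp h2).resolve_left two_ne_zero

theorem innerDer_cyclic (a b c : J) :
    innerDer (a * b) c + innerDer (b * c) a + innerDer (c * a) b = 0 := by
  ext d
  have h := jordan_linearized a b c d
  simp only [LinearMap.add_apply, innerDer_apply, LinearMap.zero_apply]
  rw [← neg_eq_zero, ← h]
  abel

theorem innerDer_mul (a b c d : J) :
    innerDer a b (c * d) = innerDer a b c * d + c * innerDer a b d := by
  have h1 := jordan_linearized c b d a
  have h2 := jordan_linearized c a d b
  have h := sub_eq_zero.mpr (h1.trans h2.symm)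
  simp only [innerDer_apply, sub_mul, mul_sub]
  rw [← sub_eq_zero, ← neg_eq_zero, ← h]
  simp only [mul_comm]
  abel

/-- `⟨J, J⟩` acts on `J` by inner derivations, `⟨a, b⟩ ↦ [L_a, L_b]`. -/
def der : Pairing J →ₗ[ℂ] (J →ₗ[ℂ] J) :=
  (pairingRel J).liftQ (TensorProduct.lift innerDer) <| by
    rw [pairingRel, Submodule.span_le]
    rintro t (⟨a, b, rfl⟩ | ⟨a, b, c, rfl⟩)
    · simp only [SetLike.mem_coe, LinearMap.mem_ker, map_add, TensorProduct.lift.tmul]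
      ext; simp
    · simp only [SetLike.mem_coe, LinearMap.mem_ker, map_add, TensorProduct.lift.tmul]
      exact innerDer_cyclic a b c

@[simp] theorem der_pair (a b : J) : der (pair a b) = innerDer a b := by
  simp [der, pair_def, Submodule.liftQ_apply]

theorem der_mul (p : Pairing J) (a b : J) : der p (a * b) = der p a * b + a * der p b := by
  induction p using pairing_induction with
  | h0 => simp
  | hp c d => rw [der_pair]; exact innerDer_mul c d a b
  | ha p q hp hq =>
    simp only [map_add, LinearMap.add_apply, hp, hq, add_mul, mul_add]
    abel

/-- `⟨J, J⟩` acts on itself, `⟨a, b⟩ · ⟨c, d⟩ = ⟨[L_a, L_b] c, d⟩ + ⟨c, [L_a, L_b] d⟩`. -/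
def derPair : Pairing J →ₗ[ℂ] Pairing J →ₗ[ℂ] Pairing J :=
  LinearMap.mk₂ ℂ (fun p q => pairMap (der p) (der_mul p) q)
    (by
      intro p p' q
      induction q using pairing_induction with
      | h0 => simp
      | hp c d => simp; abel
      | ha q q' hq hq' => rw [map_add, hq, hq', map_add, map_add]; abel)
    (by
      intro r p q
      induction q using pairing_induction with
      | h0 => simp
      | hp c d => simp
      | ha q q' hq hq' => rw [map_add, hq, hq', map_add, smul_add])
    (by intros; simp) (by intros; simp)

@[simp] theorem derPair_pair (p : Pairing J) (c d : J) :
    derPair p (pair c d) = pair (der p c) d + pair c (der p d) :=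
  pairMap_pair _ (der_mul p) _ _

/-- `⟨J, J⟩` acts on `sl₂ ⊗ J` through the second factor. -/
def actTensor : Pairing J →ₗ[ℂ] (Sl2 ⊗[ℂ] J) →ₗ[ℂ] (Sl2 ⊗[ℂ] J) :=
  (LinearMap.lTensorHom Sl2).comp der

@[simp] theorem actTensor_tmul (p : Pairing J) (A : Sl2) (c : J) :
    actTensor p (A ⊗ₜ[ℂ] c) = A ⊗ₜ[ℂ] der p c := rfl

/-- The Lie bracket of `sl₂` as a bilinear map. -/
def slBracket : Sl2 →ₗ[ℂ] Sl2 →ₗ[ℂ] Sl2 := (LieModule.toEnd ℂ Sl2 Sl2 : Sl2 →ₗ[ℂ] _)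

@[simp] theorem slBracket_apply (A B : Sl2) : slBracket A B = ⁅A, B⁆ := rfl

/-- The form `(A, B) ↦ 2 tr (A B)` on `sl₂`. -/
def slForm : Sl2 →ₗ[ℂ] Sl2 →ₗ[ℂ] ℂ :=
  LinearMap.mk₂ ℂ (fun A B => 2 * Matrix.trace ((A : Matrix (Fin 2) (Fin 2) ℂ) * B.1))
    (by intros; simp [add_mul, mul_add]) (by intros; simp; ring)
    (by intros; simp [mul_add]) (by intros; simp; ring)

@[simp] theorem slForm_apply (A B : Sl2) :
    slForm A B = 2 * Matrix.trace ((A : Matrix (Fin 2) (Fin 2) ℂ) * B.1) := rfl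

/-- `(A ⊗ a, B ⊗ b) ↦ [A, B] ⊗ ab`. -/
def tensorBracket : (Sl2 ⊗[ℂ] J) →ₗ[ℂ] (Sl2 ⊗[ℂ] J) →ₗ[ℂ] (Sl2 ⊗[ℂ] J) :=
  TensorProduct.map₂ slBracket (LinearMap.mul ℂ J)

@[simp] theorem tensorBracket_tmul (A B : Sl2) (a b : J) :
    tensorBracket (A ⊗ₜ[ℂ] a) (B ⊗ₜ[ℂ] b) = ⁅A, B⁆ ⊗ₜ[ℂ] (a * b) := rfl

/-- `(A ⊗ a, B ⊗ b) ↦ 2 tr (A B) ⟨a, b⟩`. -/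
def tensorPair : (Sl2 ⊗[ℂ] J) →ₗ[ℂ] (Sl2 ⊗[ℂ] J) →ₗ[ℂ] Pairing J :=
  (TensorProduct.map₂ slForm pair).compr₂ (TensorProduct.lid ℂ (Pairing J)).toLinearMap

@[simp] theorem tensorPair_tmul (A B : Sl2) (a b : J) :
    tensorPair (A ⊗ₜ[ℂ] a) (B ⊗ₜ[ℂ] b) =
      (2 * Matrix.trace ((A : Matrix (Fin 2) (Fin 2) ℂ) * B.1)) • pair a b := rfl

theorem tensorBracket_swap (X Y : Sl2 ⊗[ℂ] J) : tensorBracket X Y = -tensorBracket Y X := by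
  induction X using TensorProduct.induction_on with
  | zero => simp
  | add X X' hX hX' => simp only [map_add, LinearMap.add_apply, hX, hX']; abel
  | tmul A a =>
    induction Y using TensorProduct.induction_on with
    | zero => simp
    | add Y Y' hY hY' => simp only [map_add, LinearMap.add_apply, hY, hY']; abel
    | tmul B b =>
      rw [tensorBracket_tmul, tensorBracket_tmul, ← lie_skew A B, mul_comm,
        TensorProduct.neg_tmul]

theorem tensorPair_swap (X Y : Sl2 ⊗[ℂ] J) : tensorPair X Y = -tensorPair Y X := by
  induction X using TensorProduct.induction_on with
  | zero => simp
  | add X X' hX hX' => simp only [map_add, LinearMap.add_apply, hX, hX']; abel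
  | tmul A a =>
    induction Y using TensorProduct.induction_on with
    | zero => simp
    | add Y Y' hY hY' => simp only [map_add, LinearMap.add_apply, hY, hY']; abel
    | tmul B b =>
      rw [tensorPair_tmul, tensorPair_tmul, pair_swap a b, Matrix.trace_mul_comm, smul_neg]

theorem derPair_swap (p q : Pairing J) : derPair p q = -derPair q p := by
  induction p using pairing_induction with
  | h0 => simp
  | ha p p' hp hp' => simp only [map_add, LinearMap.add_apply, hp, hp']; abel
  | hp a b =>
    induction q using pairing_induction with
    | h0 => simp
    | ha q q' hq hq' => simp only [map_add, LinearMap.add_apply, hq, hq']; abel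
    | hp c d =>
      simp only [derPair_pair, der_pair, innerDer_apply, map_sub, LinearMap.sub_apply]
      have e1 := pair_cyclic (b * c) d a
      have e2 := pair_cyclic (a * c) d b
      have e3 := pair_cyclic (b * d) c a
      have e4 := pair_cyclic (a * d) c b
      simp only [pair_swap c, pair_swap a (c * (d * b)), pair_swap a (d * (c * b)),
        pair_swap (d * a) (b * c), pair_swap (d * b) (a * c)] at e1 e2 e3 e4 ⊢
      simp only [mul_comm] at e1 e2 e3 e4 ⊢
      linear_combination (norm := module) e1 - e2 - e3 + e4

theorem pair_invariant (p : Pairing J) (X Y : Sl2 ⊗[ℂ] J) :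
    derPair p (tensorPair X Y) = tensorPair (actTensor p X) Y + tensorPair X (actTensor p Y) := by
  induction X using TensorProduct.induction_on with
  | zero => simp
  | add X X' hX hX' => simp only [map_add, LinearMap.add_apply, hX, hX']; abel
  | tmul A a =>
    induction Y using TensorProduct.induction_on with
    | zero => simp
    | add Y Y' hY hY' => simp only [map_add, hY, hY']; abel
    | tmul B b => simp only [tensorPair_tmul, map_smul, derPair_pair, actTensor_tmul, smul_add]

theorem bracket_invariant (p : Pairing J) (X Y : Sl2 ⊗[ℂ] J) :
    actTensor p (tensorBracket X Y) =
      tensorBracket (actTensor p X) Y + tensorBracket X (actTensor p Y) := by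
  induction X using TensorProduct.induction_on with
  | zero => simp
  | add X X' hX hX' => simp only [map_add, LinearMap.add_apply, hX, hX']; abel
  | tmul A a =>
    induction Y using TensorProduct.induction_on with
    | zero => simp
    | add Y Y' hY hY' => simp only [map_add, hY, hY']; abel
    | tmul B b =>
      simp only [tensorBracket_tmul, actTensor_tmul, der_mul, TensorProduct.tmul_add]

theorem der_derPair (p q : Pairing J) (c : J) :
    der p (der q c) = der (derPair p q) c + der q (der p c) := by
  induction q using pairing_induction with
  | h0 => simp
  | ha q q' hq hq' => simp only [map_add, LinearMap.add_apply, hq, hq']; abel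
  | hp a b =>
    simp only [derPair_pair, map_add, der_pair, LinearMap.add_apply, innerDer_apply, map_sub,
      der_mul, mul_add]
    abel

theorem actTensor_derPair (p q : Pairing J) (X : Sl2 ⊗[ℂ] J) :
    actTensor p (actTensor q X) = actTensor (derPair p q) X + actTensor q (actTensor p X) := by
  induction X using TensorProduct.induction_on with
  | zero => simp
  | add X X' hX hX' => simp only [map_add, hX, hX']; abel
  | tmul A a =>
    simp only [actTensor_tmul]
    rw [der_derPair, TensorProduct.tmul_add]

theorem derPair_derPair (p q r : Pairing J) :
    derPair p (derPair q r) = derPair (derPair p q) r + derPair q (derPair p r) := by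
  induction r using pairing_induction with
  | h0 => simp
  | ha r r' hr hr' => simp only [map_add, hr, hr']; abel
  | hp a b =>
    simp only [derPair_pair, map_add, der_derPair p q, LinearMap.add_apply]
    abel

theorem tensorPair_jacobi (X Y Z : Sl2 ⊗[ℂ] J) :
    tensorPair X (tensorBracket Y Z) =
      tensorPair (tensorBracket X Y) Z + tensorPair Y (tensorBracket X Z) := by
  induction X using TensorProduct.induction_on with
  | zero => simp
  | add X X' hX hX' => simp only [map_add, LinearMap.add_apply, hX, hX']; abel
  | tmul A a =>
    induction Y using TensorProduct.induction_on with
    | zero => simp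
    | add Y Y' hY hY' => simp only [map_add, LinearMap.add_apply, hY, hY']; abel
    | tmul B b =>
      induction Z using TensorProduct.induction_on with
      | zero => simp
      | add Z Z' hZ hZ' => simp only [map_add, hZ, hZ']; abel
      | tmul C c =>
        have h1 : Matrix.trace (A.1 * (⁅B, C⁆ : Sl2).1) =
            Matrix.trace ((⁅A, B⁆ : Sl2).1 * C.1) := by
          simp only [LieAlgebra.SpecialLinear.sl_bracket, Matrix.mul_sub, Matrix.sub_mul,
            Matrix.trace_sub, Matrix.mul_assoc]
          rw [Matrix.trace_mul_comm A.1 (C.1 * B.1), Matrix.mul_assoc,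
            Matrix.trace_mul_comm C.1, Matrix.mul_assoc]
        have h2 : Matrix.trace (B.1 * (⁅A, C⁆ : Sl2).1) =
            -Matrix.trace ((⁅A, B⁆ : Sl2).1 * C.1) := by
          rw [← h1, ← Matrix.trace_neg, ← Matrix.mul_neg]
          simp only [LieAlgebra.SpecialLinear.sl_bracket, Matrix.mul_sub,
            Matrix.trace_sub, neg_sub]
          rw [← Matrix.mul_assoc, Matrix.trace_mul_comm (B.1 * A.1), ← Matrix.mul_assoc,
            ← Matrix.mul_assoc, ← Matrix.mul_assoc, Matrix.trace_mul_comm (B.1 * C.1),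
            ← Matrix.mul_assoc, Matrix.trace_mul_comm (C.1 * B.1), ← Matrix.mul_assoc]
        simp only [tensorPair_tmul, tensorBracket_tmul, h1, h2]
        rw [pair_swap a, pair_swap b]
        have h := pair_cyclic a b c
        rw [mul_comm c a] at h
        linear_combination (norm := module)
          (-2 * Matrix.trace ((⁅A, B⁆ : Sl2).1 * C.1)) • h

theorem sl2_bracket_bracket (A B C : Sl2) :
    ⁅A, ⁅B, C⁆⁆ = (2 * Matrix.trace (A.1 * B.1)) • C - (2 * Matrix.trace (A.1 * C.1)) • B := by
  have hA : A.1 1 1 = -A.1 0 0 := by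
    have h : Matrix.trace A.1 = 0 := A.2
    rw [Matrix.trace_fin_two] at h
    linear_combination h
  have hB : B.1 1 1 = -B.1 0 0 := by
    have h : Matrix.trace B.1 = 0 := B.2
    rw [Matrix.trace_fin_two] at h
    linear_combination h
  have hC : C.1 1 1 = -C.1 0 0 := by
    have h : Matrix.trace C.1 = 0 := C.2
    rw [Matrix.trace_fin_two] at h
    linear_combination h
  apply Subtype.ext
  ext i j
  fin_cases i <;> fin_cases j <;>
    simp [Ring.lie_def, Matrix.mul_apply, Matrix.trace_fin_two, hA, hB, hC] <;>
    ring

theorem tensorBracket_jacobi (X Y Z : Sl2 ⊗[ℂ] J) :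
    tensorBracket X (tensorBracket Y Z) - actTensor (tensorPair Y Z) X =
      tensorBracket (tensorBracket X Y) Z + actTensor (tensorPair X Y) Z +
        (tensorBracket Y (tensorBracket X Z) - actTensor (tensorPair X Z) Y) := by
  induction X using TensorProduct.induction_on with
  | zero => simp
  | add X X' hX hX' =>
    simp only [map_add, LinearMap.add_apply]
    linear_combination (norm := module) hX + hX'
  | tmul A a =>
    induction Y using TensorProduct.induction_on with
    | zero => simp
    | add Y Y' hY hY' =>
      simp only [map_add, LinearMap.add_apply]
      linear_combination (norm := module) hY + hY'
    | tmul B b =>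
      induction Z using TensorProduct.induction_on with
      | zero => simp
      | add Z Z' hZ hZ' =>
        simp only [map_add, LinearMap.add_apply]
        linear_combination (norm := module) hZ + hZ'
      | tmul C c =>
        rw [tensorBracket_tmul, tensorBracket_tmul, tensorBracket_tmul, tensorBracket_tmul,
          tensorBracket_tmul, tensorBracket_tmul, ← lie_skew ⁅A, B⁆ C,
          sl2_bracket_bracket, sl2_bracket_bracket, sl2_bracket_bracket]
        simp only [tensorPair_tmul, map_smul, LinearMap.smul_apply, actTensor_tmul, der_pair,
          innerDer_apply, Matrix.trace_mul_comm C.1, Matrix.trace_mul_comm B.1 A.1]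
        simp only [TensorProduct.neg_tmul, TensorProduct.sub_tmul, ← TensorProduct.smul_tmul',
          TensorProduct.tmul_sub, mul_comm]
        module

variable (J)

/-- The TKK Lie algebra `(sl₂ ⊗ J) ⊕ ⟨J, J⟩` of `J`. -/
def TKKAlgebra : Type _ := (Sl2 ⊗[ℂ] J) × Pairing J

instance : AddCommGroup (TKKAlgebra J) := inferInstanceAs (AddCommGroup ((Sl2 ⊗[ℂ] J) × Pairing J))

instance : Module ℂ (TKKAlgebra J) := inferInstanceAs (Module ℂ ((Sl2 ⊗[ℂ] J) × Pairing J))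

variable {J}

/-- The inclusion of `sl₂ ⊗ J`. -/
def ofTensor : (Sl2 ⊗[ℂ] J) →ₗ[ℂ] TKKAlgebra J := LinearMap.inl ℂ (Sl2 ⊗[ℂ] J) (Pairing J)

/-- The inclusion of `⟨J, J⟩`. -/
def ofPairing : Pairing J →ₗ[ℂ] TKKAlgebra J := LinearMap.inr ℂ (Sl2 ⊗[ℂ] J) (Pairing J)

@[simp] theorem ofTensor_fst (X : Sl2 ⊗[ℂ] J) : (ofTensor X).1 = X := rfl
@[simp] theorem ofTensor_snd (X : Sl2 ⊗[ℂ] J) : (ofTensor X).2 = 0 := rfl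
@[simp] theorem ofPairing_fst (p : Pairing J) : (ofPairing p).1 = 0 := rfl
@[simp] theorem ofPairing_snd (p : Pairing J) : (ofPairing p).2 = p := rfl

theorem ofTensor_add_ofPairing (x : TKKAlgebra J) : ofTensor x.1 + ofPairing x.2 = x :=
  Prod.ext (add_zero _) (zero_add _)

instance : Bracket (TKKAlgebra J) (TKKAlgebra J) where
  bracket x y :=
    (tensorBracket x.1 y.1 + actTensor x.2 y.1 - actTensor y.2 x.1,
      tensorPair x.1 y.1 + derPair x.2 y.2)

theorem lie_def (x y : TKKAlgebra J) :
    ⁅x, y⁆ = ofTensor (tensorBracket x.1 y.1 + actTensor x.2 y.1 - actTensor y.2 x.1) +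
      ofPairing (tensorPair x.1 y.1 + derPair x.2 y.2) :=
  (ofTensor_add_ofPairing _).symm

theorem lie_fst (x y : TKKAlgebra J) :
    ⁅x, y⁆.1 = tensorBracket x.1 y.1 + actTensor x.2 y.1 - actTensor y.2 x.1 := rfl

theorem lie_snd (x y : TKKAlgebra J) : ⁅x, y⁆.2 = tensorPair x.1 y.1 + derPair x.2 y.2 := rfl

theorem add_fst (x y : TKKAlgebra J) : (x + y).1 = x.1 + y.1 := rfl
theorem add_snd (x y : TKKAlgebra J) : (x + y).2 = x.2 + y.2 := rfl
theorem smul_fst (r : ℂ) (x : TKKAlgebra J) : (r • x).1 = r • x.1 := rfl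
theorem smul_snd (r : ℂ) (x : TKKAlgebra J) : (r • x).2 = r • x.2 := rfl
theorem zero_fst : (0 : TKKAlgebra J).1 = 0 := rfl
theorem zero_snd : (0 : TKKAlgebra J).2 = 0 := rfl

theorem eq_zero_of_eq_neg {V : Type*} [AddCommGroup V] [Module ℂ V] {v : V} (h : v = -v) :
    v = 0 := by
  have h2 : (2 : ℂ) • v = 0 := by linear_combination (norm := module) h
  exact (smul_eq_zero.mp h2).resolve_left two_ne_zero

instance : LieRing (TKKAlgebra J) where
  add_lie x y z := by
    refine Prod.ext ?_ ?_
    · simp only [lie_fst, add_fst, add_snd, map_add, LinearMap.add_apply]; abel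
    · simp only [lie_snd, add_fst, add_snd, map_add, LinearMap.add_apply]; abel
  lie_add x y z := by
    refine Prod.ext ?_ ?_
    · simp only [lie_fst, add_fst, add_snd, map_add, LinearMap.add_apply]; abel
    · simp only [lie_snd, add_fst, add_snd, map_add]; abel
  lie_self x := by
    refine Prod.ext ?_ ?_
    · simp only [lie_fst, add_sub_cancel_right, zero_fst]
      exact eq_zero_of_eq_neg (tensorBracket_swap _ _)
    · simp only [lie_snd, zero_snd]
      rw [eq_zero_of_eq_neg (tensorPair_swap x.1 x.1), eq_zero_of_eq_neg (derPair_swap x.2 x.2),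
        add_zero]
  leibniz_lie x y z := by
    refine Prod.ext ?_ ?_
    · simp only [lie_fst, lie_snd, add_fst, map_add, map_sub, LinearMap.add_apply,
        LinearMap.sub_apply]
      have h1 := tensorBracket_jacobi x.1 y.1 z.1
      have h2 := bracket_invariant x.2 y.1 z.1
      have h3 := bracket_invariant y.2 x.1 z.1
      have h4 := bracket_invariant z.2 x.1 y.1
      have h5 := actTensor_derPair x.2 y.2 z.1
      have h6 := actTensor_derPair x.2 z.2 y.1
      have h7 := actTensor_derPair y.2 z.2 x.1
      have h8 := tensorBracket_swap (actTensor z.2 x.1) y.1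
      rw [h8] at h4
      linear_combination (norm := module) h1 + h2 - h3 + h4 + h5 - h6 + h7
    · simp only [lie_fst, lie_snd, add_snd, map_add, map_sub, LinearMap.add_apply,
        LinearMap.sub_apply]
      have h1 := tensorPair_jacobi x.1 y.1 z.1
      have h2 := pair_invariant x.2 y.1 z.1
      have h3 := pair_invariant y.2 x.1 z.1
      have h4 := pair_invariant z.2 x.1 y.1
      have h5 := derPair_derPair x.2 y.2 z.2
      have h6 := derPair_swap (tensorPair x.1 y.1) z.2
      rw [h6]
      have h7 := tensorPair_swap (actTensor z.2 x.1) y.1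
      rw [h7] at h4
      linear_combination (norm := module) h1 + h2 - h3 + h4 + h5

instance : LieAlgebra ℂ (TKKAlgebra J) where
  lie_smul r x y := by
    refine Prod.ext ?_ ?_
    · simp only [lie_fst, smul_fst, smul_snd, map_smul, LinearMap.smul_apply, smul_add, smul_sub]
    · simp only [lie_snd, smul_snd, smul_fst, map_smul, smul_add]

/-! The defining brackets. -/

theorem lie_ofTensor_ofTensor (A B : Sl2) (a b : J) :
    ⁅ofTensor (A ⊗ₜ[ℂ] a), ofTensor (B ⊗ₜ[ℂ] b)⁆ =
      ofTensor (⁅A, B⁆ ⊗ₜ[ℂ] (a * b)) + ofPairing ((2 * Matrix.trace (A.1 * B.1)) • pair a b) := by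
  rw [lie_def]; simp

theorem lie_ofPairing_ofTensor (a b c : J) (A : Sl2) :
    ⁅ofPairing (pair a b), ofTensor (A ⊗ₜ[ℂ] c)⁆ =
      ofTensor (A ⊗ₜ[ℂ] (a * (b * c) - b * (a * c))) := by
  rw [lie_def]; simp

theorem lie_ofPairing_ofPairing (a b c d : J) :
    ⁅ofPairing (pair a b), ofPairing (pair c d)⁆ =
      ofPairing (pair (a * (b * c) - b * (a * c)) d + pair c (a * (b * d) - b * (a * d))) := by
  rw [lie_def]; simp

/-- The operator on the TKK algebra induced by a derivation `D` of `J`: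
`A ⊗ a ↦ A ⊗ D a`, `⟨a, b⟩ ↦ ⟨D a, b⟩ + ⟨a, D b⟩`. -/
def extendDer (D : J →ₗ[ℂ] J) (hD : ∀ a b, D (a * b) = D a * b + a * D b) :
    TKKAlgebra J →ₗ[ℂ] TKKAlgebra J :=
  LinearMap.prodMap (LinearMap.lTensor Sl2 D) (pairMap D hD)

theorem extendDer_ofTensor (D : J →ₗ[ℂ] J) (hD : ∀ a b, D (a * b) = D a * b + a * D b)
    (A : Sl2) (a : J) : extendDer D hD (ofTensor (A ⊗ₜ[ℂ] a)) = ofTensor (A ⊗ₜ[ℂ] D a) :=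
  Prod.ext rfl (map_zero (pairMap D hD))

theorem extendDer_ofPairing (D : J →ₗ[ℂ] J) (hD : ∀ a b, D (a * b) = D a * b + a * D b)
    (a b : J) : extendDer D hD (ofPairing (pair a b)) = ofPairing (pair (D a) b + pair a (D b)) :=
  Prod.ext (map_zero (LinearMap.lTensor Sl2 D)) rfl

end Construction

/-! ## The Jordan algebra of the non-lattice semi-lattice in `ℤ²` -/

/-- `S₀ = 2ℤ²`. -/
def S₀ : Set (ℤ × ℤ) := {ρ | Even ρ.1 ∧ Even ρ.2}

/-- `S₁ = e₁ + 2ℤ²`. -/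
def S₁ : Set (ℤ × ℤ) := {ρ | Odd ρ.1 ∧ Even ρ.2}

/-- `S₂ = e₂ + 2ℤ²`. -/
def S₂ : Set (ℤ × ℤ) := {ρ | Even ρ.1 ∧ Odd ρ.2}

/-- The semi-lattice `S = S₀ ∪ S₁ ∪ S₂`. -/
def S : Set (ℤ × ℤ) := S₀ ∪ S₁ ∪ S₂

/-- The vector space with basis the symbols `x^ρ`, `ρ ∈ S`. -/
def Jordan : Type := S →₀ ℂ

instance : AddCommGroup Jordan := inferInstanceAs (AddCommGroup (S →₀ ℂ))

instance : Module ℂ Jordan := inferInstanceAs (Module ℂ (S →₀ ℂ))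

open Classical in
/-- The element `x^ρ` if `ρ ∈ S`, and `0` otherwise. -/
def mono (ρ : ℤ × ℤ) : Jordan :=
  if h : ρ ∈ S then (Finsupp.single (⟨ρ, h⟩ : S) (1 : ℂ) : S →₀ ℂ) else (0 : S →₀ ℂ)

/-- The bilinear product with `x^ρ · x^τ = x^(ρ + τ)` if `ρ + τ ∈ S`, and `0` otherwise. -/
def mulHom : Jordan →ₗ[ℂ] Jordan →ₗ[ℂ] Jordan :=
  Finsupp.linearCombination ℂ fun ρ : S =>
    (Finsupp.linearCombination ℂ fun τ : S => mono (ρ.1 + τ.1) : (S →₀ ℂ) →ₗ[ℂ] Jordan)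

theorem mono_of_mem {ρ : ℤ × ℤ} (h : ρ ∈ S) :
    mono ρ = (Finsupp.single (⟨ρ, h⟩ : S) (1 : ℂ) : S →₀ ℂ) := dif_pos h

theorem mono_of_notMem {ρ : ℤ × ℤ} (h : ρ ∉ S) : mono ρ = 0 := dif_neg h

theorem jordan_induction {P : Jordan → Prop} (a : Jordan) (h0 : P 0)
    (hm : ∀ ρ ∈ S, P (mono ρ)) (hs : ∀ (r : ℂ) a, P a → P (r • a))
    (ha : ∀ a b, P a → P b → P (a + b)) : P a := by
  refine Finsupp.induction_linear (motive := P) a h0 ha ?_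
  intro ρ r
  have h := hs r _ (hm ρ.1 ρ.2)
  rw [mono_of_mem ρ.2] at h
  have e : (r • (Finsupp.single ρ (1 : ℂ)) : S →₀ ℂ) = Finsupp.single ρ r := by simp
  exact e ▸ h

theorem mulHom_mono {ρ τ : ℤ × ℤ} (hρ : ρ ∈ S) (hτ : τ ∈ S) :
    mulHom (mono ρ) (mono τ) = mono (ρ + τ) := by
  rw [mono_of_mem hρ, mono_of_mem hτ]
  have h : mulHom (Finsupp.single (⟨ρ, hρ⟩ : S) (1 : ℂ) : S →₀ ℂ) =
      (Finsupp.linearCombination ℂ fun τ : S => mono (ρ + τ.1) : (S →₀ ℂ) →ₗ[ℂ] Jordan) :=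
    (Finsupp.linearCombination_single ℂ _ _).trans (one_smul ℂ _)
  exact (DFunLike.congr_fun h _).trans
    ((Finsupp.linearCombination_single ℂ _ _).trans (one_smul ℂ _))

instance : NonUnitalNonAssocCommRing Jordan where
  mul a b := mulHom a b
  left_distrib a b c := map_add (mulHom a) b c
  right_distrib a b c := LinearMap.map_add₂ mulHom a b c
  zero_mul a := LinearMap.map_zero₂ mulHom a
  mul_zero a := map_zero (mulHom a)
  mul_comm a b := by
    change mulHom a b = mulHom b a
    induction a using jordan_induction with
    | h0 => simp
    | hs r a h => simp [h]
    | ha a a' h h' => simp [h, h']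
    | hm ρ hρ =>
      induction b using jordan_induction with
      | h0 => simp
      | hs r a h => simp [h]
      | ha a a' h h' => simp [h, h']
      | hm τ hτ => rw [mulHom_mono hρ hτ, mulHom_mono hτ hρ, add_comm]

theorem mul_def (a b : Jordan) : a * b = mulHom a b := rfl

theorem mono_mul_mono {ρ τ : ℤ × ℤ} (hρ : ρ ∈ S) (hτ : τ ∈ S) :
    mono ρ * mono τ = mono (ρ + τ) := mulHom_mono hρ hτ

instance : IsScalarTower ℂ Jordan Jordan :=
  ⟨fun r a b => LinearMap.map_smul₂ mulHom r a b⟩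

instance : SMulCommClass ℂ Jordan Jordan :=
  ⟨fun r a b => (map_smul (mulHom a) r b).symm⟩

/-- The indicator of the classes of `S` modulo `2ℤ²`. -/
def ind (u : ZMod 2 × ZMod 2) : ℤ := if u = (1, 1) then 0 else 1

/-- Reduction modulo `2ℤ²`. -/
def red (ρ : ℤ × ℤ) : ZMod 2 × ZMod 2 := ((ρ.1 : ZMod 2), (ρ.2 : ZMod 2))

theorem red_add (ρ τ : ℤ × ℤ) : red (ρ + τ) = red ρ + red τ := by simp [red]

theorem mem_S_iff (ρ : ℤ × ℤ) : ρ ∈ S ↔ red ρ ≠ (1, 1) := by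
  simp only [S, S₀, S₁, S₂, Set.mem_union, Set.mem_ofPred_eq, red, ne_eq, Prod.mk.injEq,
    ZMod.intCast_eq_one_iff_odd]
  rw [← Int.not_even_iff_odd, ← Int.not_even_iff_odd]
  tauto

theorem ind_smul_mono (ρ : ℤ × ℤ) : (ind (red ρ) : ℂ) • mono ρ = mono ρ := by
  by_cases h : ρ ∈ S
  · rw [ind, if_neg ((mem_S_iff ρ).mp h)]; simp
  · rw [mono_of_notMem h, smul_zero]

theorem mono_mul_mono' (ρ τ : ℤ × ℤ) :
    mono ρ * mono τ = ((ind (red ρ) : ℂ) * ind (red τ)) • mono (ρ + τ) := by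
  by_cases hρ : ρ ∈ S
  · by_cases hτ : τ ∈ S
    · rw [mono_mul_mono hρ hτ, ind, ind, if_neg ((mem_S_iff ρ).mp hρ),
        if_neg ((mem_S_iff τ).mp hτ)]
      simp
    · have h : red τ = (1, 1) := by rw [mem_S_iff] at hτ; exact not_not.mp hτ
      rw [mono_of_notMem hτ, mul_zero, h]; simp [ind]
  · have h : red ρ = (1, 1) := by rw [mem_S_iff] at hρ; exact not_not.mp hρ
    rw [mono_of_notMem hρ, zero_mul, h]; simp [ind]

theorem ind_identity : ∀ a b c d : ZMod 2 × ZMod 2,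
    ind (a + b + c + d) * (ind a * ind b * ind c * ind d) *
      ((ind (b + c) * ind (b + c + d) - ind (b + c) * ind (a + d)) +
      (ind (c + a) * ind (c + a + d) - ind (c + a) * ind (b + d)) +
      (ind (a + b) * ind (a + b + d) - ind (a + b) * ind (c + d))) = 0 := by
  decide

theorem jordan_aux (a b c d : Jordan) :
    (a * ((b * c) * d) - (b * c) * (a * d)) + (b * ((c * a) * d) - (c * a) * (b * d)) +
      (c * ((a * b) * d) - (a * b) * (c * d)) = 0 := by
  induction a using jordan_induction with
  | h0 => simp
  | hs r a h =>
    rw [← smul_zero r, ← h]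
    simp only [smul_mul_assoc, mul_smul_comm, smul_add, smul_sub]
  | ha a a' h h' =>
    rw [← add_zero (0 : Jordan)]
    nth_rewrite 1 [← h]
    rw [← h']
    simp only [add_mul, mul_add]
    abel
  | hm α hα =>
  induction b using jordan_induction with
  | h0 => simp
  | hs r a h =>
    rw [← smul_zero r, ← h]
    simp only [smul_mul_assoc, mul_smul_comm, smul_add, smul_sub]
  | ha a a' h h' =>
    rw [← add_zero (0 : Jordan)]
    nth_rewrite 1 [← h]
    rw [← h']
    simp only [add_mul, mul_add]
    abel
  | hm β hβ =>
  induction c using jordan_induction with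
  | h0 => simp
  | hs r a h =>
    rw [← smul_zero r, ← h]
    simp only [smul_mul_assoc, mul_smul_comm, smul_add, smul_sub]
  | ha a a' h h' =>
    rw [← add_zero (0 : Jordan)]
    nth_rewrite 1 [← h]
    rw [← h']
    simp only [add_mul, mul_add]
    abel
  | hm γ hγ =>
  induction d using jordan_induction with
  | h0 => simp
  | hs r a h =>
    rw [← smul_zero r, ← h]
    simp only [mul_smul_comm, smul_add, smul_sub]
  | ha a a' h h' =>
    rw [← add_zero (0 : Jordan)]
    nth_rewrite 1 [← h]
    rw [← h']
    simp only [mul_add]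
    abel
  | hm δ hδ =>
  have key := ind_identity (red α) (red β) (red γ) (red δ)
  have key' := congrArg (fun z : ℤ => (z : ℂ)) key
  push_cast at key'
  simp only [mono_mul_mono', mul_smul_comm, smul_mul_assoc, smul_smul, red_add]
  rw [show α + (β + γ + δ) = α + β + γ + δ by abel, show β + γ + (α + δ) = α + β + γ + δ by abel,
    show β + (γ + α + δ) = α + β + γ + δ by abel, show γ + α + (β + δ) = α + β + γ + δ by abel,
    show γ + (α + β + δ) = α + β + γ + δ by abel, show α + β + (γ + δ) = α + β + γ + δ by abel,
    ← ind_smul_mono (α + β + γ + δ)]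
  simp only [red_add, smul_smul, ← sub_smul, ← add_smul]
  rw [← zero_smul ℂ (mono (α + β + γ + δ)), ← key']
  congr 1
  ring

instance : IsCommJordan Jordan where
  lmul_comm_rmul_rmul a b := by
    have h := jordan_aux a a a b
    have h3 : (3 : ℂ) • (a * (a * a * b) - a * a * (a * b)) = 0 := by
      rw [← h]; module
    have h4 := (smul_eq_zero.mp h3).resolve_left three_ne_zero
    rw [sub_eq_zero] at h4
    rw [mul_comm (a * b), ← h4, mul_comm (a * a) b]

/-- For an additive `f : ℤ² → ℤ`, the derivation `x^ρ ↦ f(ρ) x^ρ` of the Jordan algebra. -/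
def degDer (f : ℤ × ℤ →+ ℤ) : Jordan →ₗ[ℂ] Jordan :=
  Finsupp.linearCombination ℂ fun ρ : S => (f ρ.1 : ℂ) • mono ρ.1

theorem degDer_mono (f : ℤ × ℤ →+ ℤ) (ρ : ℤ × ℤ) : degDer f (mono ρ) = (f ρ : ℂ) • mono ρ := by
  by_cases h : ρ ∈ S
  · nth_rewrite 1 [mono_of_mem h]
    rw [degDer]
    erw [Finsupp.linearCombination_single]
    rw [one_smul]
  · rw [mono_of_notMem h, map_zero, smul_zero]

theorem degDer_mul (f : ℤ × ℤ →+ ℤ) (a b : Jordan) :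
    degDer f (a * b) = degDer f a * b + a * degDer f b := by
  induction a using jordan_induction with
  | h0 => simp
  | hs r a h => simp only [smul_mul_assoc, map_smul, h, smul_add]
  | ha a a' h h' => simp only [add_mul, map_add, h, h']; abel
  | hm ρ hρ =>
    induction b using jordan_induction with
    | h0 => simp
    | hs r a h => simp only [mul_smul_comm, map_smul, h, smul_add]
    | ha a a' h h' => simp only [mul_add, map_add, h, h']; abel
    | hm τ hτ =>
      rw [mono_mul_mono hρ hτ, degDer_mono, degDer_mono, degDer_mono, smul_mul_assoc,
        mul_smul_comm, mono_mul_mono hρ hτ, ← add_smul, map_add]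
      push_cast
      rfl

/-! ## The baby TKK algebra -/

/-- The baby TKK algebra. -/
abbrev BabyTKK : Type := TKKAlgebra Jordan

/-- The Chevalley generator `x₊` of `sl₂`. -/
def sl2Pos : Sl2 := LieAlgebra.SpecialLinear.single 0 1 (by decide) 1

/-- The Chevalley generator `x₋` of `sl₂`. -/
def sl2Neg : Sl2 := LieAlgebra.SpecialLinear.single 1 0 (by decide) 1

/-- The coroot `α^∨ = diag (1, -1)` of `sl₂`. -/
def sl2Coroot : Sl2 := LieAlgebra.SpecialLinear.singleSubSingle 0 1 1

/-- `x₊(ρ)`, which is zero if `ρ ∉ S`. -/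
def xPos (ρ : ℤ × ℤ) : BabyTKK := ofTensor (sl2Pos ⊗ₜ[ℂ] mono ρ)

/-- `x₋(ρ)`, which is zero if `ρ ∉ S`. -/
def xNeg (ρ : ℤ × ℤ) : BabyTKK := ofTensor (sl2Neg ⊗ₜ[ℂ] mono ρ)

open Classical in
/-- `α^∨(ρ)`, equal to `α^∨ ⊗ x^ρ` if `ρ ∈ S` and to `2⟨x^e₁, x^(ρ - e₁)⟩` otherwise. -/
def coroot (ρ : ℤ × ℤ) : BabyTKK :=
  if ρ ∈ S then ofTensor (sl2Coroot ⊗ₜ[ℂ] mono ρ)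
  else (2 : ℂ) • ofPairing (pair (mono (1, 0)) (mono (ρ - (1, 0))))

open Classical in
/-- `C₁(ρ)`. -/
def C₁ (ρ : ℤ × ℤ) : BabyTKK :=
  if ρ ∈ S₀ then ofPairing (pair (mono (1, 0)) (mono (ρ - (1, 0)))) else 0

open Classical in
/-- `C₂(ρ)`. -/
def C₂ (ρ : ℤ × ℤ) : BabyTKK :=
  if ρ ∈ S₀ then ofPairing (pair (mono (0, 1)) (mono (ρ - (0, 1)))) else 0

/-- The degree derivation `d₁`. -/
def d₁ : BabyTKK →ₗ[ℂ] BabyTKK :=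
  extendDer (degDer (AddMonoidHom.fst ℤ ℤ)) (degDer_mul _)

/-- The degree derivation `d₂`. -/
def d₂ : BabyTKK →ₗ[ℂ] BabyTKK :=
  extendDer (degDer (AddMonoidHom.snd ℤ ℤ)) (degDer_mul _)

/-- The component of degree `n` of the `ℤ`-grading given by `-d₁`. -/
def degreePart (n : ℤ) : Submodule ℂ BabyTKK := Module.End.eigenspace d₁ (-(n : ℂ))

/-- The triple `(k, m, n)` stands for the functional `k α + m δ₁ + n δ₂` on
`𝔥 = span (α^∨, C₁, C₂, d₁, d₂)`, which takes the values `2k, 0, 0, m, n` there. This is the space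
of the elements of the baby TKK algebra on which `𝔥` acts through that functional. -/
def rootSpace (β : ℤ × ℤ × ℤ) : Submodule ℂ BabyTKK :=
  Module.End.eigenspace (LieAlgebra.ad ℂ BabyTKK (coroot 0)) (2 * (β.1 : ℂ)) ⊓
    Module.End.eigenspace (LieAlgebra.ad ℂ BabyTKK (C₁ 0)) 0 ⊓
    Module.End.eigenspace (LieAlgebra.ad ℂ BabyTKK (C₂ 0)) 0 ⊓
    Module.End.eigenspace d₁ (β.2.1 : ℂ) ⊓
    Module.End.eigenspace d₂ (β.2.2 : ℂ)

/-- The set `Δ` of the `± α + m δ₁ + n δ₂` with `(m, n) ∈ S` and of all `m δ₁ + n δ₂`. -/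
def roots : Set (ℤ × ℤ × ℤ) := {β | ((β.1 = 1 ∨ β.1 = -1) ∧ β.2 ∈ S) ∨ β.1 = 0}

/-- The set `Δ₊`. -/
def posRoots : Set (ℤ × ℤ × ℤ) := {β ∈ roots | (β.1 = 1 ∧ β.2.1 = 0) ∨ 0 < β.2.1}

/-- The set `Δ₀` of the `n δ₂`. -/
def zeroRoots : Set (ℤ × ℤ × ℤ) := {β | β.1 = 0 ∧ β.2.1 = 0}

/-- The positive part of the triangular decomposition. -/
def posPart : Submodule ℂ BabyTKK := ⨆ β ∈ posRoots, rootSpace β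

/-- The middle part `ℋ` of the triangular decomposition. -/
def zeroPart : Submodule ℂ BabyTKK := ⨆ β ∈ zeroRoots, rootSpace β

theorem C₂_zero : C₂ 0 = ofPairing (pair (mono (0, 1)) (mono (0, -1))) := by
  rw [C₂, if_pos (by simp [S₀])]
  rfl

theorem C₁_zero : C₁ 0 = ofPairing (pair (mono (1, 0)) (mono (-1, 0))) := by
  rw [C₁, if_pos (by simp [S₀])]
  rfl

theorem C₂_mem_rootSpace : C₂ 0 ∈ rootSpace 0 := by
  have h0 : (0 : ℤ × ℤ) ∈ S := by simp [mem_S_iff, red]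
  have h1 : ((0, 1) : ℤ × ℤ) ∈ S := by simp [mem_S_iff, red]
  have h2 : ((0, -1) : ℤ × ℤ) ∈ S := by simp [mem_S_iff, red]
  have h3 : ((1, 0) : ℤ × ℤ) ∈ S := by simp [mem_S_iff, red]
  have h4 : ((-1, 0) : ℤ × ℤ) ∈ S := by simp [mem_S_iff, red]
  have h5 : ((-1, 1) : ℤ × ℤ) ∉ S := by simp [mem_S_iff, red]
  have h6 : ((1, 1) : ℤ × ℤ) ∉ S := by simp [mem_S_iff, red]
  have h7 : ((-1, -1) : ℤ × ℤ) ∉ S := by simp [mem_S_iff, red]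
  have h8 : ((1, -1) : ℤ × ℤ) ∉ S := by simp [mem_S_iff, red]
  rw [C₂_zero]
  refine ⟨⟨⟨⟨?_, ?_⟩, ?_⟩, ?_⟩, ?_⟩
  · simp only [SetLike.mem_coe, Module.End.mem_eigenspace_iff, LieAlgebra.ad_apply]
    rw [coroot, if_pos h0, ← lie_skew, lie_ofPairing_ofTensor, mono_mul_mono h2 h0,
      mono_mul_mono h1 h0, add_zero, add_zero, mul_comm, sub_self]
    simp
  · simp only [SetLike.mem_coe, Module.End.mem_eigenspace_iff, LieAlgebra.ad_apply]
    rw [C₁_zero, lie_ofPairing_ofPairing]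
    simp [mono_mul_mono h3 h1, mono_mul_mono h3 h2, mono_mul_mono h4 h1, mono_mul_mono h4 h2,
      mono_of_notMem h5, mono_of_notMem h6, mono_of_notMem h7, mono_of_notMem h8]
  · simp only [SetLike.mem_coe, Module.End.mem_eigenspace_iff, LieAlgebra.ad_apply]
    rw [C₂_zero, lie_self, zero_smul]
  · simp only [SetLike.mem_coe, Module.End.mem_eigenspace_iff]
    rw [d₁, extendDer_ofPairing, degDer_mono, degDer_mono]
    simp
  · simp only [SetLike.mem_coe, Module.End.mem_eigenspace_iff]
    rw [d₂, extendDer_ofPairing, degDer_mono, degDer_mono]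
    simp

theorem C₂_mem_zeroPart : C₂ 0 ∈ zeroPart :=
  Submodule.mem_iSup_of_mem 0 (Submodule.mem_iSup_of_mem ⟨rfl, rfl⟩ C₂_mem_rootSpace)

/-! ## Modules for the baby TKK algebra -/

section Modules

variable (W : Type*) [AddCommGroup W] [Module ℂ W] [LieRingModule BabyTKK W]
  [LieModule ℂ BabyTKK W]

/-- Restricted modules. -/
def IsRestricted : Prop :=
  ∀ (w : W) (n s : ℤ), s ≠ 0 → ∃ M : ℤ, ∀ m ≥ M,
    ⁅xPos (m, n), w⁆ = 0 ∧ ⁅xNeg (m, n), w⁆ = 0 ∧ ⁅coroot (m, n), w⁆ = 0 ∧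
      ⁅C₁ (2 * m, 2 * s), w⁆ = 0 ∧ ⁅C₂ (2 * m, 0), w⁆ = 0

/-- Integrable modules: the `x_±(ρ)`, `ρ ∈ S`, act locally nilpotently. -/
def IsIntegrable : Prop :=
  ∀ ρ ∈ S, ∀ w : W,
    (∃ k : ℕ, (LieModule.toEnd ℂ BabyTKK W (xPos ρ) ^ k) w = 0) ∧
      ∃ k : ℕ, (LieModule.toEnd ℂ BabyTKK W (xNeg ρ) ^ k) w = 0

variable {W}

/-- An `ℕ`-grading `W = ⨁ W_(n)` of a module: the component of degree `k` of the baby TKK algebra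
maps `W_(n)` to `W_(n + k)`, which is zero if `n + k < 0`. -/
structure IsNGrading (gr : ℕ → Submodule ℂ W) : Prop where
  isInternal : DirectSum.IsInternal gr
  lie_mem : ∀ (k : ℤ) (n n' : ℕ), (n' : ℤ) = n + k → ∀ u ∈ degreePart k, ∀ w ∈ gr n,
    ⁅u, w⁆ ∈ gr n'
  lie_eq_zero : ∀ (k : ℤ) (n : ℕ), (n : ℤ) + k < 0 → ∀ u ∈ degreePart k, ∀ w ∈ gr n, ⁅u, w⁆ = 0

end Modules

end TKK

end

noncomputable section

open scoped TensorProduct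

set_option linter.unusedSectionVars false

/-! The degree is minus the `δ₁`-coefficient, so every root vector with positive `δ₁`-coefficient
kills the lowest nonzero component `gr n₀` of `W`. Inside `gr n₀`, the `x₊(0,n)` raise the
`α^∨`-weight by 2. A vector of maximal weight there is therefore killed by the positive part, and it
remains to find a maximal weight and to diagonalize `ℋ` on its weight space.

Both start from integrability. For every integer `n` the real roots `±α + 2δ₁ + nδ₂` give
`sl₂`-triples whose raising element kills `gr n₀` and whose lowering element is locally nilpotent,
so their coroots have eigenvalues in `ℕ` on suitable invariant subspaces (`exists_nat_eigenvector`).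
These coroots are `±α^∨ + 2D + 2nC₂` with `D` and `C₂` central. On a common eigenvector of `α^∨` and
`D` the number `μ + 2d + 2nc` must be natural for all integers `n`, which forces the scalar `c` of
`C₂` to vanish. The roots `-α + 2δ₁` then bound the weights of `gr n₀` from above
(`level_eq_zero_and_weights_bounded`).

Let `Ω` be a top weight space of `gr n₀`. By the triangular decomposition, applying the negative
part to a subspace of `Ω` only adds lower weights or other degrees, so `Ω` is irreducible under the
zero generators (`top_weight_space_irreducible`). Their commutators are multiples of `C₂`, hence
zero on `W`. Since `W` has countable dimension over the uncountable field `ℂ`, the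
countable-dimensional form of Schur's lemma makes these generators act by scalars, so `Ω` is a line
(`top_weight_space_eq_span`). As `ℋ` preserves degree and weight, it acts on that line through a
functional. -/

namespace TKK

/-! ### Linear algebra: Schur's lemma in countable dimension, and `sl₂`-eigenvalues -/

section LinearAlgebra

variable {V : Type*} [AddCommGroup V] [Module ℂ V]

-- Over `ℂ` a nonzero polynomial splits into linear factors, and a composite of injective maps is
-- injective.
open Polynomial in
theorem injective_aeval_of_forall_injective {f : Module.End ℂ V}
    (hf : ∀ z : ℂ, Function.Injective (f - algebraMap ℂ (Module.End ℂ V) z)) :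
    ∀ (n : ℕ) (p : ℂ[X]), p.natDegree = n → p ≠ 0 → Function.Injective (aeval f p) := by
  intro n
  induction n with
  | zero =>
    intro p hn hp
    obtain ⟨a, rfl⟩ := natDegree_eq_zero.mp hn
    have ha : a ≠ 0 := by rintro rfl; simp at hp
    intro x y h
    simp only [aeval_C, Module.algebraMap_end_apply] at h
    exact smul_right_injective V ha h
  | succ n ih =>
    intro p hn hp
    obtain ⟨z, hz⟩ := IsAlgClosed.exists_root p (by
      rw [degree_eq_natDegree hp, hn]; exact_mod_cast Nat.succ_ne_zero n)
    obtain ⟨q, rfl⟩ := dvd_iff_isRoot.mpr hz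
    have hq : q ≠ 0 := right_ne_zero_of_mul hp
    have hd : q.natDegree = n := by
      rw [natDegree_mul (X_sub_C_ne_zero z) hq, natDegree_X_sub_C] at hn
      omega
    rw [map_mul, map_sub, aeval_X, aeval_C]
    exact (hf z).comp (ih q hd hq)

open Polynomial in
/-- On a nonzero complex vector space of countable dimension, every endomorphism has a spectral
value. -/
theorem exists_not_bijective_sub_algebraMap [Nontrivial V]
    (hV : Module.rank ℂ V ≤ Cardinal.aleph0) (f : Module.End ℂ V) :
    ∃ z : ℂ, ¬ Function.Bijective (f - algebraMap ℂ (Module.End ℂ V) z) := by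
  by_contra! hb
  have hp := fun (p : ℂ[X]) => injective_aeval_of_forall_injective (fun z => (hb z).1) _ p rfl
  obtain ⟨v, hv⟩ := exists_ne (0 : V)
  choose u hu using fun z => (hb z).2 v
  -- If every `f - z` were bijective, the vectors `(f - z)⁻¹ v` would be linearly independent, as
  -- partial fractions are. There are continuum many of them, too many for a countable dimension.
  have hli : LinearIndependent ℂ u := by
    rw [linearIndependent_iff']
    intro s c hc i hi
    -- Clear denominators: apply the product of all `f - k`, `k ∈ s`, to the linear relation.
    have key : aeval f (∑ j ∈ s, C (c j) * ∏ k ∈ s.erase j, (X - C k)) v = 0 := by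
      have h := congrArg (aeval f (∏ k ∈ s, (X - C k))) hc
      rw [map_zero, map_sum] at h
      rw [map_sum, LinearMap.sum_apply, ← h]
      refine Finset.sum_congr rfl fun j hj => ?_
      have hj' : aeval f (X - C j) (u j) = v := by
        rw [map_sub, aeval_X, aeval_C, hu]
      rw [map_smul, ← Finset.prod_erase_mul s _ hj, map_mul, map_mul, Module.End.mul_apply,
        Module.End.mul_apply, hj', aeval_C, Module.algebraMap_end_apply]
    have h0 : ∑ j ∈ s, C (c j) * ∏ k ∈ s.erase j, (X - C k) = 0 := by
      by_contra h0
      exact hv (hp _ h0 (by rw [key, map_zero]))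
    -- At `i` every summand except the `i`-th has a vanishing factor.
    have h1 := congrArg (eval i) h0
    rw [eval_finsetSum, eval_zero, Finset.sum_eq_single i] at h1
    · rw [eval_mul, eval_C, eval_prod] at h1
      refine (mul_eq_zero.mp h1).resolve_right (Finset.prod_ne_zero_iff.mpr fun k hk => ?_)
      simpa [sub_eq_zero] using (Finset.ne_of_mem_erase hk).symm
    · intro j _ hji
      rw [eval_mul, eval_prod, Finset.prod_eq_zero (Finset.mem_erase.mpr ⟨hji.symm, hi⟩) (by simp),
        mul_zero]
    · exact fun h => absurd hi h
  have h2 := hli.cardinal_lift_le_rank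
  rw [Cardinal.mk_complex, Cardinal.lift_continuum] at h2
  exact absurd (h2.trans (Cardinal.lift_le.mpr hV)) (by
    rw [Cardinal.lift_aleph0]; exact not_le.mpr Cardinal.aleph0_lt_continuum)

/-- A commuting family of operators acting irreducibly on a space of countable dimension acts by
scalars. -/
theorem exists_eq_smul_of_commuting_irreducible (Ω : Submodule ℂ V) (hΩ : Ω ≠ ⊥)
    (hV : Module.rank ℂ V ≤ Cardinal.aleph0) (F : Set (Module.End ℂ V))
    (hmem : ∀ f ∈ F, ∀ v ∈ Ω, f v ∈ Ω)
    (hcomm : ∀ f ∈ F, ∀ g ∈ F, ∀ v ∈ Ω, f (g v) = g (f v))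
    (hirr : ∀ N ≤ Ω, N ≠ ⊥ → (∀ f ∈ F, ∀ v ∈ N, f v ∈ N) → N = Ω) :
    ∀ f ∈ F, ∃ z : ℂ, ∀ v ∈ Ω, f v = z • v := by
  intro f hf
  have : Nontrivial Ω := Submodule.nontrivial_iff_ne_bot.mpr hΩ
  obtain ⟨z, hz⟩ := exists_not_bijective_sub_algebraMap ((Submodule.rank_le Ω).trans hV)
    (f.restrict (hmem f hf))
  refine ⟨z, ?_⟩
  set g : Module.End ℂ Ω := f.restrict (hmem f hf) - algebraMap ℂ _ z with hg
  have hgv (v : Ω) : (g v : V) = f v - z • (v : V) := rfl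
  have hgF (h : Module.End ℂ V) (hh : h ∈ F) (v : Ω) :
      (g ⟨h v, hmem h hh v v.2⟩ : V) = h (g v) := by
    rw [hgv, hgv, map_sub, map_smul, hcomm f hf h hh v v.2]
  -- Kernel and range of `g = f - z` are both stable under `F`. A zero kernel would make the range
  -- all of `Ω`, hence `g` bijective; a nonzero kernel is all of `Ω`.
  by_cases hk : LinearMap.ker g = ⊥
  · exfalso
    refine hz ⟨LinearMap.ker_eq_bot.mp hk, ?_⟩
    have hr := hirr ((LinearMap.range g).map Ω.subtype) (Submodule.map_subtype_le _ _) (by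
      intro h
      obtain ⟨v, hv⟩ := exists_ne (0 : Ω)
      apply hv
      apply LinearMap.ker_eq_bot.mp hk
      rw [map_zero]
      apply Subtype.ext
      exact (Submodule.mem_bot ℂ).mp (h ▸ Submodule.mem_map_of_mem (LinearMap.mem_range_self g v)))
      (by
      rintro h hh _ ⟨_, ⟨v, rfl⟩, rfl⟩
      exact ⟨_, ⟨⟨h v, hmem h hh v v.2⟩, rfl⟩, hgF h hh v⟩)
    intro w
    obtain ⟨_, ⟨v, rfl⟩, hv⟩ := hr.ge w.2
    exact ⟨v, Subtype.ext hv⟩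
  · have hr := hirr ((LinearMap.ker g).map Ω.subtype) (Submodule.map_subtype_le _ _) 
      (fun h => hk (Submodule.map_injective_of_injective Ω.subtype_injective
        (by rw [h, Submodule.map_bot]))) (by
      rintro h hh _ ⟨v, hv, rfl⟩
      refine ⟨⟨h v, hmem h hh v v.2⟩, ?_, rfl⟩
      apply Subtype.ext
      rw [hgF h hh, LinearMap.mem_ker.mp hv]
      simp)
    intro v hv
    obtain ⟨w, hw, rfl⟩ := hr.ge hv
    have := hgv w
    rw [LinearMap.mem_ker.mp hw] at this
    exact sub_eq_zero.mp this.symm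

/-- A space generated by one vector under a countable set of operators has countable dimension. -/
theorem rank_le_aleph0_of_cyclic (F : Set (Module.End ℂ V)) (hF : F.Countable) (v : V)
    (hgen : ∀ N : Submodule ℂ V, v ∈ N → (∀ f ∈ F, ∀ w ∈ N, f w ∈ N) → N = ⊤) :
    Module.rank ℂ V ≤ Cardinal.aleph0 := by
  have : Countable F := hF
  -- The words in `F` applied to `v` span, and there are only countably many words.
  let φ : List F → V := fun l => (l.map Subtype.val).prod v
  have htop : Submodule.span ℂ (Set.range φ) = ⊤ := by
    apply hgen
    · exact Submodule.subset_span ⟨[], by simp [φ]⟩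
    · intro f hf w hw
      have : Submodule.span ℂ (Set.range φ) ≤ (Submodule.span ℂ (Set.range φ)).comap f := by
        rw [Submodule.span_le]
        rintro _ ⟨l, rfl⟩
        exact Submodule.subset_span ⟨⟨f, hf⟩ :: l, by simp [φ]⟩
      exact this hw
  rw [← rank_top, ← htop]
  exact (rank_span_le _).trans (Set.countable_range φ).le_aleph0

/-- If `e` vanishes on a subspace `U` of an `sl₂`-module that is stable under `h`, and `f` is
nilpotent on some nonzero vector of `U`, then `h` has an eigenvector in `U` with eigenvalue a
natural number. -/
theorem exists_eigenvector_of_nilpotent (e f h : Module.End ℂ V) (U : Submodule ℂ V)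
    (hef : ∀ v, e (f v) = f (e v) + h v) (hhf : ∀ v, h (f v) = f (h v) - (2 : ℂ) • f v)
    (he : ∀ v ∈ U, e v = 0) (hU : ∀ v ∈ U, h v ∈ U) (k : ℕ) :
    ∀ v ∈ U, v ≠ 0 → (f ^ k) v = 0 → ∃ w ∈ U, w ≠ 0 ∧ ∃ j : ℕ, h w = (j : ℂ) • w := by
  have hfk (k : ℕ) (v : V) : h ((f ^ k) v) = (f ^ k) (h v) - (2 * k : ℂ) • (f ^ k) v := by
    induction k with
    | zero => simp
    | succ k ih =>
      rw [pow_succ', Module.End.mul_apply, Module.End.mul_apply, hhf, ih, map_sub, map_smul]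
      push_cast
      module
  -- The usual `sl₂` identity `e f^(k+1) v = (k+1) f^k (h - k) v`, with `h` kept as an operator
  -- because `v` need not be an eigenvector.
  have hek (k : ℕ) (v : V) (hv : v ∈ U) :
      e ((f ^ (k + 1)) v) = (k + 1 : ℂ) • (f ^ k) (h v - (k : ℂ) • v) := by
    induction k with
    | zero => simp [hef, he v hv]
    | succ k ih =>
      rw [pow_succ', Module.End.mul_apply, hef, ih, hfk, pow_succ', map_smul,
        Module.End.mul_apply]
      simp only [Module.End.mul_apply, map_sub, map_smul]
      push_cast
      module
  induction k with
  | zero => intro v _ hv h0; exact absurd (by simpa using h0) hv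
  | succ k ih =>
    intro v hvU hv h0
    -- Either `v` is already an eigenvector, or `(h - k) v` is a nonzero vector of `U` killed by the
    -- smaller power `f^k`.
    by_cases hw : h v - (k : ℂ) • v = 0
    · exact ⟨v, hvU, hv, k, sub_eq_zero.mp hw⟩
    · refine ih _ (U.sub_mem (hU v hvU) (U.smul_mem _ hvU)) hw ?_
      have h1 := hek k v hvU
      rw [h0, map_zero] at h1
      exact (smul_eq_zero.mp h1.symm).resolve_left (by exact_mod_cast Nat.succ_ne_zero k)

end LinearAlgebra

/-! ### Structure of the baby TKK algebra -/

/-- The only class modulo `2ℤ²` missing from `S` is `(1,1)`. Exponents with even first coordinate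
thus form a group inside `S`, on which the Jordan product never degenerates; this is why `(0,n)` and
`(2,n)` are the exponents used below. -/
theorem mem_S_of_even_fst {ρ : ℤ × ℤ} (h : Even ρ.1) : ρ ∈ S := by
  rcases Int.even_or_odd ρ.2 with h2 | h2
  · exact Or.inl (Or.inl ⟨h, h2⟩)
  · exact Or.inr ⟨h, h2⟩

theorem zero_mem_S : (0 : ℤ × ℤ) ∈ S := mem_S_of_even_fst Even.zero

theorem mono_zero_mul (a : Jordan) : mono 0 * a = a := by
  induction a using jordan_induction with
  | h0 => simp
  | hm ρ hρ => rw [mono_mul_mono zero_mem_S hρ, zero_add]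
  | hs r a h => rw [mul_smul_comm, h]
  | ha a b h h' => rw [mul_add, h, h']

theorem coroot_of_mem {ρ : ℤ × ℤ} (h : ρ ∈ S) :
    coroot ρ = ofTensor (sl2Coroot ⊗ₜ[ℂ] mono ρ) := if_pos h

theorem sl2Pos_val : sl2Pos.1 = !![0, 1; 0, 0] := by
  ext i j; fin_cases i <;> fin_cases j <;> simp [sl2Pos, Matrix.single]

theorem sl2Neg_val : sl2Neg.1 = !![0, 0; 1, 0] := by
  ext i j; fin_cases i <;> fin_cases j <;> simp [sl2Neg, Matrix.single]

theorem sl2Coroot_val : sl2Coroot.1 = !![1, 0; 0, -1] := by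
  ext i j; fin_cases i <;> fin_cases j <;> simp [sl2Coroot, Matrix.single]

theorem lie_sl2Pos_sl2Neg : ⁅sl2Pos, sl2Neg⁆ = sl2Coroot := by
  apply Subtype.ext
  rw [LieAlgebra.SpecialLinear.sl_bracket, sl2Pos_val, sl2Neg_val, sl2Coroot_val]
  ext i j; fin_cases i <;> fin_cases j <;> simp

theorem lie_sl2Coroot_sl2Pos : ⁅sl2Coroot, sl2Pos⁆ = (2 : ℂ) • sl2Pos := by
  apply Subtype.ext
  rw [LieAlgebra.SpecialLinear.sl_bracket, Submodule.coe_smul, sl2Pos_val, sl2Coroot_val]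
  ext i j; fin_cases i <;> fin_cases j <;> simp; norm_num

theorem lie_sl2Coroot_sl2Neg : ⁅sl2Coroot, sl2Neg⁆ = (-2 : ℂ) • sl2Neg := by
  apply Subtype.ext
  rw [LieAlgebra.SpecialLinear.sl_bracket, Submodule.coe_smul, sl2Neg_val, sl2Coroot_val]
  ext i j; fin_cases i <;> fin_cases j <;> simp; norm_num

theorem trace_sl2Pos_sl2Neg : Matrix.trace (sl2Pos.1 * sl2Neg.1) = 1 := by
  rw [sl2Pos_val, sl2Neg_val]; simp [Matrix.trace_fin_two]

theorem trace_sl2Coroot_sl2Pos : Matrix.trace (sl2Coroot.1 * sl2Pos.1) = 0 := by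
  rw [sl2Pos_val, sl2Coroot_val]; simp [Matrix.trace_fin_two]

theorem trace_sl2Coroot_sl2Neg : Matrix.trace (sl2Coroot.1 * sl2Neg.1) = 0 := by
  rw [sl2Neg_val, sl2Coroot_val]; simp [Matrix.trace_fin_two]

theorem sl2_eq (A : Sl2) :
    A = A.1 0 1 • sl2Pos + A.1 1 0 • sl2Neg + A.1 0 0 • sl2Coroot := by
  have hA : A.1 1 1 = -A.1 0 0 := by
    have h : Matrix.trace A.1 = 0 := A.2
    rw [Matrix.trace_fin_two] at h
    linear_combination h
  apply Subtype.ext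
  change A.1 = A.1 0 1 • sl2Pos.1 + A.1 1 0 • sl2Neg.1 + A.1 0 0 • sl2Coroot.1
  rw [sl2Pos_val, sl2Neg_val, sl2Coroot_val]
  ext i j; fin_cases i <;> fin_cases j <;> simp [hA]

/-- `⟨x^ρ, x^τ⟩` as an element of the baby TKK algebra. -/
def monoPair (ρ τ : ℤ × ℤ) : BabyTKK := ofPairing (pair (mono ρ) (mono τ))

theorem lie_coroot_zero_ofTensor (A : Sl2) (a : Jordan) :
    ⁅coroot 0, ofTensor (A ⊗ₜ[ℂ] a)⁆ = ofTensor (⁅sl2Coroot, A⁆ ⊗ₜ[ℂ] a) +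
      ofPairing ((2 * Matrix.trace (sl2Coroot.1 * A.1)) • pair (mono 0) a) := by
  rw [coroot_of_mem zero_mem_S, lie_ofTensor_ofTensor, mono_zero_mul]

theorem lie_coroot_zero_xPos (ρ : ℤ × ℤ) : ⁅coroot 0, xPos ρ⁆ = (2 : ℂ) • xPos ρ := by
  rw [xPos, lie_coroot_zero_ofTensor, lie_sl2Coroot_sl2Pos, trace_sl2Coroot_sl2Pos]
  simp [← TensorProduct.smul_tmul']

theorem lie_coroot_zero_xNeg (ρ : ℤ × ℤ) : ⁅coroot 0, xNeg ρ⁆ = (-2 : ℂ) • xNeg ρ := by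
  rw [xNeg, lie_coroot_zero_ofTensor, lie_sl2Coroot_sl2Neg, trace_sl2Coroot_sl2Neg]
  simp [TensorProduct.neg_tmul, ← TensorProduct.smul_tmul']

/-- This is the coroot of a real `sl₂`-triple. Its correction to `α^∨` comes from `2 tr(x₊x₋) = 2`,
and is central because the two exponents sum to zero. -/
theorem lie_xPos_xNeg {ρ : ℤ × ℤ} (h : ρ ∈ S) (h' : -ρ ∈ S) :
    ⁅xPos ρ, xNeg (-ρ)⁆ = coroot 0 + (2 : ℂ) • monoPair ρ (-ρ) := by
  rw [xPos, xNeg, lie_ofTensor_ofTensor, lie_sl2Pos_sl2Neg, trace_sl2Pos_sl2Neg,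
    mono_mul_mono h h', add_neg_cancel, coroot_of_mem zero_mem_S, mul_one, map_smul, monoPair]

theorem lie_xNeg_xPos {ρ : ℤ × ℤ} (h : ρ ∈ S) (h' : -ρ ∈ S) :
    ⁅xNeg ρ, xPos (-ρ)⁆ = -coroot 0 + (2 : ℂ) • monoPair ρ (-ρ) := by
  rw [xPos, xNeg, lie_ofTensor_ofTensor, ← lie_skew sl2Neg, lie_sl2Pos_sl2Neg,
    Matrix.trace_mul_comm, trace_sl2Pos_sl2Neg,
    mono_mul_mono h h', add_neg_cancel, coroot_of_mem zero_mem_S, mul_one, map_smul, monoPair,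
    TensorProduct.neg_tmul, map_neg]

/-- Suppose the indicators outside the difference are nonzero and `t + s = (1,1)`. Then `s ≠ (1,1)`
gives `t ≠ 0`, and `r + t + s ≠ (1,1)` gives `r ≠ 0`. So both `r` and `t` lie in `{e₁, e₂}`, and the
hypothesis on `r + t` leaves only `r = t`, where the difference vanishes. The other case is
symmetric. -/
theorem ind_innerDer_identity : ∀ r t s : ZMod 2 × ZMod 2, r + t ≠ (1, 1) →
    ind r * ind t * ind s * ind (r + t + s) * (ind (t + s) - ind (r + s)) = 0 := by
  decide

theorem innerDer_mono_eq_zero {ρ τ : ℤ × ℤ} (h : red (ρ + τ) ≠ (1, 1)) :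
    innerDer (mono ρ) (mono τ) = 0 := by
  ext c
  rw [LinearMap.zero_apply]
  induction c using jordan_induction with
  | h0 => simp
  | hs r a h => rw [map_smul, h, smul_zero]
  | ha a b h h' => rw [map_add, h, h', add_zero]
  | hm σ hσ =>
    rw [red_add] at h
    have key := congrArg (fun z : ℤ => (z : ℂ)) (ind_innerDer_identity _ _ (red σ) h)
    push_cast at key
    simp only [innerDer_apply, mono_mul_mono', mul_smul_comm, smul_smul]
    rw [show τ + (ρ + σ) = ρ + τ + σ by abel, show ρ + (τ + σ) = ρ + τ + σ by abel,
      ← ind_smul_mono (ρ + τ + σ)]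
    simp only [red_add, smul_smul, ← sub_smul]
    rw [← zero_smul ℂ (mono (ρ + τ + σ)), ← key]
    congr 1
    ring

/-- `⟨x^ρ, x^τ⟩` is central unless `ρ + τ` lies outside `S`. -/
theorem monoPair_lie {ρ τ : ℤ × ℤ} (h : red (ρ + τ) ≠ (1, 1)) (u : BabyTKK) :
    ⁅monoPair ρ τ, u⁆ = 0 := by
  have hd : der (pair (mono ρ) (mono τ)) = 0 := by rw [der_pair, innerDer_mono_eq_zero h]
  have h1 (X : Sl2 ⊗[ℂ] Jordan) : actTensor (pair (mono ρ) (mono τ)) X = 0 := by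
    induction X using TensorProduct.induction_on with
    | zero => simp
    | add X Y hX hY => rw [map_add, hX, hY, add_zero]
    | tmul A a => rw [actTensor_tmul, hd, LinearMap.zero_apply, TensorProduct.tmul_zero]
  have h2 (q : Pairing Jordan) : derPair (pair (mono ρ) (mono τ)) q = 0 := by
    induction q using pairing_induction with
    | h0 => simp
    | ha p q hp hq => rw [map_add, hp, hq, add_zero]
    | hp a b => rw [derPair_pair, hd]; simp
  rw [lie_def, monoPair]
  simp [h1, h2]

theorem red_ne_of_even_fst {ρ : ℤ × ℤ} (h : Even ρ.1) : red ρ ≠ (1, 1) :=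
  (mem_S_iff ρ).mp (mem_S_of_even_fst h)

theorem monoPair_swap (ρ τ : ℤ × ℤ) : monoPair ρ τ = -monoPair τ ρ := by
  rw [monoPair, pair_swap, map_neg, monoPair]

/-! ### Additivity of the pairings on exponents with even first coordinate -/

/-- `ρ ↦ ⟨x^ρ, x^(σ - ρ)⟩` is additive on the subgroup of the `ρ` with `ρ₁` even. -/
theorem monoPair_add {ρ τ σ : ℤ × ℤ} (hρ : Even ρ.1) (hτ : Even τ.1) (hσ : Even σ.1) :
    monoPair (ρ + τ) (σ - (ρ + τ)) = monoPair ρ (σ - ρ) + monoPair τ (σ - τ) := by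
  have hk : Even (σ - (ρ + τ)).1 := hσ.sub (hρ.add hτ)
  -- The cyclic relation for three exponents summing to `σ`; all three have even first coordinate,
  -- so no product in it vanishes.
  have h := congrArg (ofPairing : Pairing Jordan →ₗ[ℂ] BabyTKK)
    (pair_cyclic (mono ρ) (mono τ) (mono (σ - (ρ + τ))))
  rw [mono_mul_mono (mem_S_of_even_fst hρ) (mem_S_of_even_fst hτ),
    mono_mul_mono (mem_S_of_even_fst hτ) (mem_S_of_even_fst hk),
    mono_mul_mono (mem_S_of_even_fst hk) (mem_S_of_even_fst hρ), map_add, map_add, map_zero,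
    show τ + (σ - (ρ + τ)) = σ - ρ by abel, show σ - (ρ + τ) + ρ = σ - τ by abel] at h
  change monoPair _ _ + monoPair _ _ + monoPair _ _ = 0 at h
  rw [monoPair_swap (σ - ρ), monoPair_swap (σ - τ)] at h
  linear_combination (norm := module) h

theorem monoPair_zsmul {ρ σ : ℤ × ℤ} (hρ : Even ρ.1) (hσ : Even σ.1) (n : ℤ) :
    monoPair (n • ρ) (σ - n • ρ) = (n : ℂ) • monoPair ρ (σ - ρ) := by
  have h0 : monoPair 0 (σ - 0) = 0 := by
    have := monoPair_add (ρ := 0) (τ := 0) Even.zero Even.zero hσ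
    rw [add_zero] at this
    simpa using this
  have hev (k : ℤ) : Even (k • ρ).1 := by
    rw [Prod.smul_fst, smul_eq_mul]; exact hρ.mul_left k
  induction n using Int.induction_on with
  | zero => rw [zero_smul, h0]; simp
  | succ n ih =>
    rw [add_smul, one_smul, monoPair_add (hev _) hρ hσ, ih]
    push_cast
    module
  | pred n ih =>
    have := monoPair_add (hev (-(n : ℤ) - 1)) hρ hσ
    rw [sub_smul, one_smul, sub_add_cancel, ih] at this
    rw [sub_smul, one_smul]
    push_cast at this ⊢
    linear_combination (norm := module) -this

theorem C₂_zero_eq_monoPair : C₂ 0 = monoPair (0, 1) (0, -1) := C₂_zero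

/-- Split `(2,n)` as `(2,0) + n(0,1)` and use additivity with `σ = 0`. The linear growth in `n` is
what later forces `C₂` to act by zero. -/
theorem monoPair_two (n : ℤ) :
    monoPair (2, n) (-(2, n)) = monoPair (2, 0) (-(2, 0)) + (n : ℂ) • C₂ 0 := by
  have h1 := monoPair_zsmul (ρ := (0, 1)) (σ := 0) Even.zero Even.zero n
  have h2 := monoPair_add (ρ := (2, 0)) (τ := (0, n)) (σ := 0) even_two Even.zero Even.zero
  rw [C₂_zero_eq_monoPair]
  simp at h1 h2 ⊢
  rw [h2, h1]

/-- `[α^∨(0, m), α^∨(0, n)]` is a multiple of `C₂`. -/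
theorem lie_coroot_coroot (m n : ℤ) : ∃ z : ℂ, ⁅coroot (0, m), coroot (0, n)⁆ = z • C₂ 0 := by
  have hS (k : ℤ) : ((0, k) : ℤ × ℤ) ∈ S := mem_S_of_even_fst Even.zero
  have hlie : ⁅coroot (0, m), coroot (0, n)⁆ =
      (2 * Matrix.trace (sl2Coroot.1 * sl2Coroot.1)) • monoPair (0, m) (0, n) := by
    rw [coroot_of_mem (hS m), coroot_of_mem (hS n), lie_ofTensor_ofTensor, lie_self,
      TensorProduct.zero_tmul, map_zero, zero_add, map_smul, monoPair]
  -- Put `f(k) = ⟨x^(0,k), x^(0,m+n-k)⟩`, so that `f(k) = k f(1)`. Skew symmetry gives `f(m+n) =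
  -- -f(0) = 0`, hence `(m+n) f(1) = 0`: either `m + n = 0` and `f(1) = C₂`, or `f(1) = 0` and the
  -- bracket vanishes.
  have hm := monoPair_zsmul (ρ := (0, 1)) (σ := (0, m + n)) Even.zero Even.zero m
  have hmn := monoPair_zsmul (ρ := (0, 1)) (σ := (0, m + n)) Even.zero Even.zero (m + n)
  have h0 := monoPair_zsmul (ρ := (0, 1)) (σ := (0, m + n)) Even.zero Even.zero 0
  simp only [Prod.smul_mk, smul_eq_mul, mul_zero, mul_one, Prod.mk_sub_mk, sub_zero,
    add_sub_cancel_left, sub_self, Int.cast_zero, zero_smul] at hm hmn h0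
  rw [monoPair_swap, h0, neg_zero] at hmn
  rw [hlie]
  clear hlie
  rcases smul_eq_zero.mp hmn.symm with h | h
  · have h' : m + n = 0 := by exact_mod_cast h
    rw [h', zero_sub] at hm
    exact ⟨_, by rw [hm, smul_smul, ← C₂_zero_eq_monoPair]⟩
  · exact ⟨0, by rw [hm, h, smul_zero, smul_zero, zero_smul]⟩

/-! ### Degrees, generators and the triangular decomposition -/

theorem ofTensor_mem_degreePart (A : Sl2) (ρ : ℤ × ℤ) :
    (ofTensor (A ⊗ₜ[ℂ] mono ρ) : BabyTKK) ∈ degreePart (-ρ.1) := by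
  rw [degreePart, Module.End.mem_eigenspace_iff, d₁, extendDer_ofTensor, degDer_mono]
  simp [TensorProduct.tmul_smul]

theorem xPos_mem_degreePart (ρ : ℤ × ℤ) : xPos ρ ∈ degreePart (-ρ.1) :=
  ofTensor_mem_degreePart _ ρ

theorem xNeg_mem_degreePart (ρ : ℤ × ℤ) : xNeg ρ ∈ degreePart (-ρ.1) :=
  ofTensor_mem_degreePart _ ρ

theorem coroot_mem_degreePart (n : ℤ) : coroot (0, n) ∈ degreePart 0 := by
  have h := ofTensor_mem_degreePart sl2Coroot (0, n)
  rwa [← coroot_of_mem (mem_S_of_even_fst Even.zero), neg_zero] at h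

theorem monoPair_mem_degreePart (ρ τ : ℤ × ℤ) : monoPair ρ τ ∈ degreePart (-(ρ.1 + τ.1)) := by
  rw [degreePart, Module.End.mem_eigenspace_iff, d₁, monoPair, extendDer_ofPairing, degDer_mono,
    degDer_mono]
  simp [add_smul]

/-- The generators `A ⊗ x^ρ` and `⟨x^ρ, x^τ⟩` span. -/
theorem span_generators : Submodule.span ℂ (Set.range xPos ∪ Set.range xNeg ∪
    Set.range (fun ρ => (ofTensor (sl2Coroot ⊗ₜ[ℂ] mono ρ) : BabyTKK)) ∪
    Set.range (fun ρτ : (ℤ × ℤ) × (ℤ × ℤ) => monoPair ρτ.1 ρτ.2)) = ⊤ := by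
  rw [eq_top_iff]
  rintro u -
  rw [← ofTensor_add_ofPairing u]
  obtain ⟨X, p⟩ := u
  refine Submodule.add_mem _ ?_ ?_
  · change ofTensor X ∈ _
    induction X using TensorProduct.induction_on with
    | zero => rw [map_zero]; exact Submodule.zero_mem _
    | add X Y hX hY => rw [map_add]; exact Submodule.add_mem _ hX hY
    | tmul A a =>
      induction a using jordan_induction with
      | h0 => rw [TensorProduct.tmul_zero, map_zero]; exact Submodule.zero_mem _
      | hs r a h => rw [TensorProduct.tmul_smul, map_smul]; exact Submodule.smul_mem _ _ h
      | ha a b h h' => rw [TensorProduct.tmul_add, map_add]; exact Submodule.add_mem _ h h'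
      | hm ρ hρ =>
        rw [sl2_eq A]
        simp only [TensorProduct.add_tmul, ← TensorProduct.smul_tmul', map_add, map_smul]
        refine Submodule.add_mem _ (Submodule.add_mem _ ?_ ?_) ?_ <;>
          refine Submodule.smul_mem _ _ (Submodule.subset_span ?_)
        · exact Or.inl (Or.inl (Or.inl ⟨ρ, rfl⟩))
        · exact Or.inl (Or.inl (Or.inr ⟨ρ, rfl⟩))
        · exact Or.inl (Or.inr ⟨ρ, rfl⟩)
  · change ofPairing p ∈ _
    induction p using pairing_induction with
    | h0 => rw [map_zero]; exact Submodule.zero_mem _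
    | ha p q hp hq => rw [map_add]; exact Submodule.add_mem _ hp hq
    | hp a b =>
      induction a using jordan_induction with
      | h0 => rw [map_zero, LinearMap.zero_apply, map_zero]; exact Submodule.zero_mem _
      | hs r a h =>
        rw [map_smul, LinearMap.smul_apply, map_smul]; exact Submodule.smul_mem _ _ h
      | ha a b h h' =>
        rw [map_add, LinearMap.add_apply, map_add]; exact Submodule.add_mem _ h h'
      | hm ρ hρ =>
        induction b using jordan_induction with
        | h0 => rw [map_zero, map_zero]; exact Submodule.zero_mem _
        | hs r a h => rw [map_smul, map_smul]; exact Submodule.smul_mem _ _ h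
        | ha a b h h' => rw [map_add, map_add]; exact Submodule.add_mem _ h h'
        | hm τ hτ => exact Submodule.subset_span (Or.inr ⟨(ρ, τ), rfl⟩)

/-- The generators of the part of the baby TKK algebra that is spanned by the root spaces of the
negatives of the positive roots. -/
def negGenerators : Set BabyTKK :=
  {u | ∃ k : ℤ, 0 < k ∧ u ∈ degreePart k} ∪ Set.range fun n : ℤ => xNeg (0, n)

/-- The `α^∨(0, n)` and the `⟨x^ρ, x^τ⟩` with `ρ₁ + τ₁ = 0`. -/
def zeroGenerators : Set BabyTKK :=
  Set.range (fun n : ℤ => coroot (0, n)) ∪ {u | ∃ ρ τ : ℤ × ℤ, ρ.1 + τ.1 = 0 ∧ u = monoPair ρ τ}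

/-- Generators of the positive part. -/
def posGenerators : Set BabyTKK :=
  {u | ∃ k : ℤ, k < 0 ∧ u ∈ degreePart k} ∪ Set.range fun n : ℤ => xPos (0, n)

theorem span_triangular :
    Submodule.span ℂ (negGenerators ∪ zeroGenerators ∪ posGenerators) = ⊤ := by
  have hdeg {u : BabyTKK} {k : ℤ} (h : u ∈ degreePart k) (hk : k ≠ 0) :
      u ∈ negGenerators ∪ zeroGenerators ∪ posGenerators := by
    rcases lt_or_gt_of_ne hk with hk | hk
    · exact Or.inr (Or.inl ⟨k, hk, h⟩)
    · exact Or.inl (Or.inl (Or.inl ⟨k, hk, h⟩))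
  rw [eq_top_iff, ← span_generators]
  refine Submodule.span_mono ?_
  rintro u (((⟨⟨m, n⟩, rfl⟩ | ⟨⟨m, n⟩, rfl⟩) | ⟨⟨m, n⟩, rfl⟩) | ⟨⟨ρ, τ⟩, rfl⟩)
  · by_cases hm : m = 0
    · subst hm; exact Or.inr (Or.inr ⟨n, rfl⟩)
    · exact hdeg (xPos_mem_degreePart _) (neg_ne_zero.mpr hm)
  · by_cases hm : m = 0
    · subst hm; exact Or.inl (Or.inl (Or.inr ⟨n, rfl⟩))
    · exact hdeg (xNeg_mem_degreePart _) (neg_ne_zero.mpr hm)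
  · by_cases hm : m = 0
    · subst hm
      exact Or.inl (Or.inr (Or.inl ⟨n, coroot_of_mem (mem_S_of_even_fst Even.zero)⟩))
    · exact hdeg (ofTensor_mem_degreePart _ _) (neg_ne_zero.mpr hm)
  · by_cases h : ρ.1 + τ.1 = 0
    · exact Or.inl (Or.inr (Or.inr ⟨ρ, τ, h, rfl⟩))
    · exact hdeg (monoPair_mem_degreePart _ _) (neg_ne_zero.mpr h)

theorem monoPair_lie_of_fst_eq_zero {ρ τ : ℤ × ℤ} (h : ρ.1 + τ.1 = 0) (u : BabyTKK) :
    ⁅monoPair ρ τ, u⁆ = 0 :=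
  monoPair_lie (red_ne_of_even_fst (by rw [Prod.fst_add, h]; exact Even.zero)) u

theorem C₂_zero_lie (u : BabyTKK) : ⁅C₂ 0, u⁆ = 0 := by
  rw [C₂_zero_eq_monoPair]
  exact monoPair_lie_of_fst_eq_zero rfl u

theorem zeroGenerators_subset_degreePart : zeroGenerators ⊆ degreePart 0 := by
  rintro u (⟨n, rfl⟩ | ⟨ρ, τ, h, rfl⟩)
  · exact coroot_mem_degreePart n
  · have := monoPair_mem_degreePart ρ τ
    rwa [h, neg_zero] at this

/-- Pairings of total first exponent zero are central, so only the coroots contribute. Once `C₂`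
acts by zero, the zero generators act as commuting operators. -/
theorem lie_zeroGenerators {u w : BabyTKK} (hu : u ∈ zeroGenerators) (hw : w ∈ zeroGenerators) :
    ∃ z : ℂ, ⁅u, w⁆ = z • C₂ 0 := by
  rcases hu with ⟨m, rfl⟩ | ⟨ρ, τ, h, rfl⟩
  · rcases hw with ⟨n, rfl⟩ | ⟨ρ, τ, h, rfl⟩
    · exact lie_coroot_coroot m n
    · exact ⟨0, by rw [← lie_skew, monoPair_lie_of_fst_eq_zero h, neg_zero, zero_smul]⟩
  · exact ⟨0, by rw [monoPair_lie_of_fst_eq_zero h, zero_smul]⟩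

theorem coroot_zero_mem_zeroGenerators : coroot 0 ∈ zeroGenerators := Or.inl ⟨0, rfl⟩

/-! ### Irreducible modules: invariant subspaces, central elements, countable dimension -/

section IrreducibleModules

variable {W : Type*} [AddCommGroup W] [Module ℂ W] [LieRingModule BabyTKK W]
  [LieModule ℂ BabyTKK W]

/-- A subspace that is stable under a spanning set is stable under the whole algebra. -/
theorem lie_mem_of_span_eq_top {s : Set BabyTKK} (hs : Submodule.span ℂ s = ⊤) {P : Submodule ℂ W}
    {w : W} (h : ∀ u ∈ s, ⁅u, w⁆ ∈ P) (u : BabyTKK) : ⁅u, w⁆ ∈ P := by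
  have hu : u ∈ Submodule.span ℂ s := hs ▸ Submodule.mem_top
  induction hu using Submodule.span_induction with
  | mem x hx => exact h x hx
  | zero => rw [zero_lie]; exact P.zero_mem
  | add x y _ _ hx hy => rw [add_lie]; exact P.add_mem hx hy
  | smul a x _ hx => rw [smul_lie]; exact P.smul_mem a hx

theorem eq_top_of_lie_mem (hirr : LieModule.IsIrreducible ℂ BabyTKK W) {P : Submodule ℂ W}
    (hP : P ≠ ⊥) (h : ∀ (u : BabyTKK), ∀ w ∈ P, ⁅u, w⁆ ∈ P) : P = ⊤ := by
  let Q : LieSubmodule ℂ BabyTKK W := { P with lie_mem := fun {u w} hw => h u w hw }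
  have hQ : Q ≠ ⊥ := by
    intro hQ
    apply hP
    have := congrArg LieSubmodule.toSubmodule hQ
    rwa [LieSubmodule.bot_toSubmodule] at this
  have := congrArg LieSubmodule.toSubmodule ((eq_bot_or_eq_top Q).resolve_left hQ)
  rwa [LieSubmodule.top_toSubmodule] at this

/-- The eigenspace of `u` acting on `W`. -/
def actEigenspace (W : Type*) [AddCommGroup W] [Module ℂ W] [LieRingModule BabyTKK W]
    [LieModule ℂ BabyTKK W] (u : BabyTKK) (c : ℂ) : Submodule ℂ W :=
  Module.End.eigenspace (LieModule.toEnd ℂ BabyTKK W u) c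

theorem mem_actEigenspace {u : BabyTKK} {c : ℂ} {w : W} :
    w ∈ actEigenspace W u c ↔ ⁅u, w⁆ = c • w := by
  rw [actEigenspace, Module.End.mem_eigenspace_iff, LieModule.toEnd_apply_apply]

theorem lie_mem_actEigenspace {u x : BabyTKK} {b c : ℂ} (hx : ⁅u, x⁆ = b • x) {w : W}
    (hw : w ∈ actEigenspace W u c) : ⁅x, w⁆ ∈ actEigenspace W u (c + b) := by
  rw [mem_actEigenspace] at hw ⊢
  rw [leibniz_lie, hx, hw, smul_lie, lie_smul]
  module

/-- A central element with an eigenvector acts on an irreducible module as a scalar. -/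
theorem lie_eq_smul_of_central (hirr : LieModule.IsIrreducible ℂ BabyTKK W) {z : BabyTKK}
    (hz : ∀ u : BabyTKK, ⁅z, u⁆ = 0) {c : ℂ} {w : W} (hw : w ≠ 0) (h : ⁅z, w⁆ = c • w) (v : W) :
    ⁅z, v⁆ = c • v := by
  have htop : actEigenspace W z c = ⊤ := by
    refine eq_top_of_lie_mem hirr ?_ ?_
    · intro hb
      exact hw ((Submodule.mem_bot ℂ).mp (hb ▸ mem_actEigenspace.mpr h))
    · intro u w hw
      have := lie_mem_actEigenspace (b := 0) (x := u) (by rw [hz, zero_smul]) hw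
      rwa [add_zero] at this
  exact mem_actEigenspace.mp (htop ▸ Submodule.mem_top)

/-- Any nonzero vector generates `W`, and the algebra is spanned by countably many monomial
elements. -/
theorem rank_le_aleph0_of_isIrreducible (hirr : LieModule.IsIrreducible ℂ BabyTKK W) :
    Module.rank ℂ W ≤ Cardinal.aleph0 := by
  have := LieModule.nontrivial_of_isIrreducible ℂ BabyTKK W
  obtain ⟨v, hv⟩ := exists_ne (0 : W)
  refine rank_le_aleph0_of_cyclic (LieModule.toEnd ℂ BabyTKK W '' _) (Set.Countable.image
    ((((Set.countable_range xPos).union (Set.countable_range xNeg)).union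
      (Set.countable_range (fun ρ => (ofTensor (sl2Coroot ⊗ₜ[ℂ] mono ρ) : BabyTKK)))).union
      (Set.countable_range (fun ρτ : (ℤ × ℤ) × (ℤ × ℤ) => monoPair ρτ.1 ρτ.2))) _) v ?_
  intro N hvN hN
  refine eq_top_of_lie_mem hirr ?_ ?_
  · rintro rfl
    exact hv ((Submodule.mem_bot ℂ).mp hvN)
  · intro u w hw
    exact lie_mem_of_span_eq_top span_generators
      (fun u hu => hN _ (Set.mem_image_of_mem _ hu) w hw) u

/-! ### The lowest component of a graded module -/

theorem exists_lowest_component [Nontrivial W] {gr : ℕ → Submodule ℂ W} (hgr : IsNGrading gr) :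
    ∃ n₀, gr n₀ ≠ ⊥ ∧ ∀ n < n₀, gr n = ⊥ := by
  classical
  have h : ∃ n, gr n ≠ ⊥ := by
    by_contra! h
    have := hgr.isInternal.submodule_iSup_eq_top
    rw [iSup_eq_bot.mpr h] at this
    exact bot_ne_top this
  exact ⟨Nat.find h, Nat.find_spec h, fun n hn => not_not.mp (Nat.find_min h hn)⟩

variable {gr : ℕ → Submodule ℂ W} {n₀ : ℕ}

theorem lie_eq_zero_of_lowest (hgr : IsNGrading gr) (hlow : ∀ n < n₀, gr n = ⊥) {k : ℤ}
    (hk : k < 0) {u : BabyTKK} (hu : u ∈ degreePart k) {w : W} (hw : w ∈ gr n₀) : ⁅u, w⁆ = 0 := by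
  by_cases h : (n₀ : ℤ) + k < 0
  · exact hgr.lie_eq_zero k n₀ h u hu w hw
  · obtain ⟨n, hn⟩ := Int.eq_ofNat_of_zero_le (not_lt.mp h)
    have := hgr.lie_mem k n₀ n hn.symm u hu w hw
    rwa [hlow n (by omega), Submodule.mem_bot] at this

theorem lie_mem_of_degree_zero (hgr : IsNGrading gr) {u : BabyTKK} (hu : u ∈ degreePart 0) {w : W}
    {n : ℕ} (hw : w ∈ gr n) : ⁅u, w⁆ ∈ gr n :=
  hgr.lie_mem 0 n n (add_zero _).symm u hu w hw

/-- On subspaces of the lowest component, the coroots of the real roots `α + 2δ₁ + nδ₂` and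
`-α + 2δ₁ + nδ₂` have eigenvalues in `ℕ`. -/
theorem exists_nat_eigenvector (hgr : IsNGrading gr) (hint : IsIntegrable W)
    (hlow : ∀ n < n₀, gr n = ⊥) (n : ℤ) {ε : ℂ} (hε : ε = 1 ∨ ε = -1) {U : Submodule ℂ W}
    (hUT : U ≤ gr n₀) (hU : U ≠ ⊥)
    (hUs : ∀ w ∈ U, ⁅ε • coroot 0 + (2 : ℂ) • monoPair (2, n) (-(2, n)), w⁆ ∈ U) :
    ∃ w ∈ U, w ≠ 0 ∧
      ∃ j : ℕ, ⁅ε • coroot 0 + (2 : ℂ) • monoPair (2, n) (-(2, n)), w⁆ = (j : ℂ) • w := by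
  obtain ⟨v, hvU, hv⟩ := Submodule.exists_mem_ne_zero_of_ne_bot hU
  have hS : ((2, n) : ℤ × ℤ) ∈ S := mem_S_of_even_fst even_two
  have hS' : -((2, n) : ℤ × ℤ) ∈ S := mem_S_of_even_fst even_two.neg
  have hc (u : BabyTKK) : ⁅monoPair (2, n) (-(2, n)), u⁆ = 0 := monoPair_lie_of_fst_eq_zero rfl u
  rcases hε with rfl | rfl
  -- The triple is `x₊(2,n)`, `x₋(-2,-n)`: the first has degree `-2` and kills the lowest component,
  -- the second is nilpotent on `v` by integrability. For `ε = -1` the signs `±` are exchanged.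
  · obtain ⟨k, hk⟩ := (hint _ hS' v).2
    refine exists_eigenvector_of_nilpotent (LieModule.toEnd ℂ BabyTKK W (xPos (2, n)))
      (LieModule.toEnd ℂ BabyTKK W (xNeg (-(2, n))))
      (LieModule.toEnd ℂ BabyTKK W ((1 : ℂ) • coroot 0 + (2 : ℂ) • monoPair (2, n) (-(2, n)))) U
      ?_ ?_ ?_ hUs k v hvU hv hk
    · intro w
      simp only [LieModule.toEnd_apply_apply]
      rw [leibniz_lie, lie_xPos_xNeg hS hS', one_smul]
      abel
    · intro w
      simp only [LieModule.toEnd_apply_apply]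
      rw [leibniz_lie, add_lie, smul_lie, smul_lie, lie_coroot_zero_xNeg, hc, smul_zero, add_zero,
        one_smul, smul_lie]
      module
    · intro w hw
      exact lie_eq_zero_of_lowest hgr hlow (by norm_num) (xPos_mem_degreePart _) (hUT hw)
  · obtain ⟨k, hk⟩ := (hint _ hS' v).1
    refine exists_eigenvector_of_nilpotent (LieModule.toEnd ℂ BabyTKK W (xNeg (2, n)))
      (LieModule.toEnd ℂ BabyTKK W (xPos (-(2, n))))
      (LieModule.toEnd ℂ BabyTKK W ((-1 : ℂ) • coroot 0 + (2 : ℂ) • monoPair (2, n) (-(2, n)))) U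
      ?_ ?_ ?_ hUs k v hvU hv hk
    · intro w
      simp only [LieModule.toEnd_apply_apply]
      rw [leibniz_lie, lie_xNeg_xPos hS hS', neg_one_smul]
      abel
    · intro w
      simp only [LieModule.toEnd_apply_apply]
      rw [leibniz_lie, add_lie, smul_lie, smul_lie, lie_coroot_zero_xPos, hc, smul_zero, add_zero,
        smul_smul, smul_lie]
      module
    · intro w hw
      exact lie_eq_zero_of_lowest hgr hlow (by norm_num) (xNeg_mem_degreePart _) (hUT hw)

theorem coroot_zero_mem_degreePart : coroot 0 ∈ degreePart 0 := coroot_mem_degreePart 0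

theorem monoPair_neg_mem_degreePart (ρ : ℤ × ℤ) : monoPair ρ (-ρ) ∈ degreePart 0 := by
  have := monoPair_mem_degreePart ρ (-ρ)
  rwa [Prod.fst_neg, add_neg_cancel, neg_zero] at this

/-! ### Vanishing of the level and maximal weights -/

/-- `C₂` acts trivially, and the weights of the lowest component with respect to `α^∨` are bounded
from above. -/
theorem level_eq_zero_and_weights_bounded (hirr : LieModule.IsIrreducible ℂ BabyTKK W)
    (hgr : IsNGrading gr) (hint : IsIntegrable W) (hne : gr n₀ ≠ ⊥)
    (hlow : ∀ n < n₀, gr n = ⊥) :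
    (∀ w : W, ⁅C₂ 0, w⁆ = 0) ∧ (∃ ν, gr n₀ ⊓ actEigenspace W (coroot 0) ν ≠ ⊥) ∧
      ∃ d : ℂ, ∀ ν, gr n₀ ⊓ actEigenspace W (coroot 0) ν ≠ ⊥ → ∃ j : ℕ, -ν + d = j := by
  set D := monoPair (2, 0) (-(2, 0)) with hD
  have hDz (u : BabyTKK) : ⁅D, u⁆ = 0 := monoPair_lie_of_fst_eq_zero rfl u
  have hDdeg : D ∈ degreePart 0 := monoPair_neg_mem_degreePart _
  have hdeg (ε : ℂ) (n : ℤ) : ε • coroot 0 + (2 : ℂ) • monoPair (2, n) (-(2, n)) ∈ degreePart 0 :=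
    Submodule.add_mem _ (Submodule.smul_mem _ _ coroot_zero_mem_degreePart)
      (Submodule.smul_mem _ _ (monoPair_neg_mem_degreePart _))
  obtain ⟨w₁, hw₁, hw₁0, j₁, hj₁⟩ := exists_nat_eigenvector hgr hint hlow 0 (Or.inl rfl) le_rfl hne
    fun w hw => lie_mem_of_degree_zero hgr (hdeg 1 0) hw
  -- Searching inside the `j₁`-eigenspace of `α^∨ + 2D` for an eigenvector of `-α^∨ + 2D` gives a
  -- joint eigenvector; difference and sum of the two eigenvalues then yield those of `α^∨` and `D`.
  obtain ⟨w₂, hw₂, hw₂0, j₂, hj₂⟩ := exists_nat_eigenvector hgr hint hlow 0 (Or.inr rfl)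
    (U := gr n₀ ⊓ actEigenspace W
      ((1 : ℂ) • coroot 0 + (2 : ℂ) • monoPair (2, 0) (-(2, 0))) (j₁ : ℂ))
    inf_le_left (Submodule.ne_bot_iff _ |>.mpr ⟨w₁, ⟨hw₁, mem_actEigenspace.mpr hj₁⟩, hw₁0⟩) (by
      rintro w ⟨hw, hw'⟩
      refine ⟨lie_mem_of_degree_zero hgr (hdeg (-1) 0) hw, ?_⟩
      have := lie_mem_actEigenspace (b := 0)
        (x := (-1 : ℂ) • coroot 0 + (2 : ℂ) • monoPair (2, 0) (-(2, 0))) ?_ hw'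
      · rwa [add_zero] at this
      · rw [← hD, add_lie, smul_lie, smul_lie, hDz, lie_add, lie_smul, lie_smul, lie_self,
          ← lie_skew, hDz]
        simp)
  have ha : ⁅coroot 0, w₂⁆ = (((j₁ : ℂ) - j₂) / 2) • w₂ := by
    have := mem_actEigenspace.mp hw₂.2
    simp only [add_lie, smul_lie] at this hj₂
    linear_combination (norm := module) (1 / 2 : ℂ) • this - (1 / 2 : ℂ) • hj₂
  have hDw : ⁅D, w₂⁆ = (((j₁ : ℂ) + j₂) / 4) • w₂ := by
    have := mem_actEigenspace.mp hw₂.2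
    simp only [add_lie, smul_lie, ← hD] at this hj₂
    linear_combination (norm := module) (1 / 4 : ℂ) • this + (1 / 4 : ℂ) • hj₂
  set μ := ((j₁ : ℂ) - j₂) / 2
  set d := ((j₁ : ℂ) + j₂) / 4
  have hd := lie_eq_smul_of_central hirr hDz hw₂0 hDw
  have hstab (ε ν : ℂ) (n : ℤ) (w : W) (hw : w ∈ gr n₀ ⊓ actEigenspace W (coroot 0) ν) :
      ⁅ε • coroot 0 + (2 : ℂ) • monoPair (2, n) (-(2, n)), w⁆ ∈
        gr n₀ ⊓ actEigenspace W (coroot 0) ν := by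
    refine ⟨lie_mem_of_degree_zero hgr (hdeg ε n) hw.1, ?_⟩
    have := lie_mem_actEigenspace (b := 0)
      (x := ε • coroot 0 + (2 : ℂ) • monoPair (2, n) (-(2, n))) ?_ hw.2
    · rwa [add_zero] at this
    · rw [lie_add, lie_smul, lie_smul, lie_self, ← lie_skew, monoPair_lie_of_fst_eq_zero rfl]
      simp
  have hμ : gr n₀ ⊓ actEigenspace W (coroot 0) μ ≠ ⊥ :=
    Submodule.ne_bot_iff _ |>.mpr ⟨w₂, ⟨hw₂.1, mem_actEigenspace.mpr ha⟩, hw₂0⟩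
  have hpos (n : ℤ) := exists_nat_eigenvector hgr hint hlow n (Or.inl rfl) inf_le_left hμ
    (hstab 1 μ n)
  -- On the `μ`-weight space `α^∨` and `D` are scalars, so an eigenvector of the coroot for `n = 1`
  -- is one of `C₂`.
  have hC : ∃ c : ℂ, ∀ w : W, ⁅C₂ 0, w⁆ = c • w := by
    obtain ⟨w, hw, hw0, j, hj⟩ := hpos 1
    refine ⟨((j : ℂ) - μ - 2 * d) / 2, lie_eq_smul_of_central hirr C₂_zero_lie hw0 ?_⟩
    rw [monoPair_two, ← hD, add_lie, smul_lie, smul_lie, add_lie, smul_lie, hd,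
      mem_actEigenspace.mp hw.2] at hj
    push_cast at hj
    linear_combination (norm := module) (1 / 2 : ℂ) • hj
  obtain ⟨c, hc⟩ := hC
  have hnat (n : ℤ) : ∃ j : ℕ, μ + 2 * d + 2 * n * c = j := by
    obtain ⟨w, hw, hw0, j, hj⟩ := hpos n
    refine ⟨j, smul_left_injective ℂ hw0 ?_⟩
    rw [monoPair_two, ← hD, add_lie, smul_lie, smul_lie, add_lie, smul_lie, hd, hc,
      mem_actEigenspace.mp hw.2] at hj
    change (μ + 2 * d + 2 * n * c) • w = (j : ℂ) • w
    linear_combination (norm := module) hj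
  -- An arithmetic progression indexed by `ℤ` with values in `ℕ` is constant: with values `a` at 0
  -- and `b` at 1, a nonzero difference makes it negative at `a + 1` or at `-(a + 1)`.
  have hc0 : c = 0 := by
    obtain ⟨a, ha⟩ := hnat 0
    obtain ⟨b, hb⟩ := hnat 1
    obtain ⟨p, hp⟩ := hnat (a + 1)
    obtain ⟨q, hq⟩ := hnat (-(a + 1))
    have hp' : (p : ℤ) = a + (a + 1) * (b - a) := by
      have : (p : ℂ) = a + (a + 1) * (b - a) := by
        rw [← hp]; push_cast at ha hb ⊢; linear_combination (-a : ℂ) * ha + (a + 1 : ℂ) * hb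
      exact_mod_cast this
    have hq' : (q : ℤ) = a - (a + 1) * (b - a) := by
      have : (q : ℂ) = a - (a + 1) * (b - a) := by
        rw [← hq]; push_cast at ha hb ⊢; linear_combination (a + 2 : ℂ) * ha - (a + 1 : ℂ) * hb
      exact_mod_cast this
    have hab : (b : ℤ) = a := by
      rcases lt_trichotomy (b : ℤ) a with h | h | h
      · nlinarith [Int.natCast_nonneg p, Int.natCast_nonneg a]
      · exact h
      · nlinarith [Int.natCast_nonneg q, Int.natCast_nonneg a]
    have hab' : (b : ℂ) = a := by exact_mod_cast hab
    push_cast at ha hb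
    linear_combination (1 / 2 : ℂ) * hb - (1 / 2 : ℂ) * ha + (1 / 2 : ℂ) * hab'
  refine ⟨fun w => by rw [hc, hc0, zero_smul], ⟨μ, hμ⟩, 2 * d, fun ν hν => ?_⟩
  -- The root `-α + 2δ₁` alone bounds the weights: its coroot acts on the `ν`-weight space as `-ν +
  -- 2d`.
  obtain ⟨w, hw, hw0, j, hj⟩ := exists_nat_eigenvector hgr hint hlow 0 (Or.inr rfl) inf_le_left hν
    (hstab (-1) ν 0)
  refine ⟨j, smul_left_injective ℂ hw0 ?_⟩
  rw [← hD, add_lie, smul_lie, smul_lie, hd, mem_actEigenspace.mp hw.2] at hj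
  change (-ν + 2 * d) • w = (j : ℂ) • w
  linear_combination (norm := module) hj

/-- Each step from `ν` to `ν + 2` lowers the natural number `-ν + d` by 2, so the climb must stop.
-/
theorem exists_top_weight {p : ℂ → Prop} (hp : ∃ ν, p ν) (d : ℂ)
    (hd : ∀ ν, p ν → ∃ j : ℕ, -ν + d = j) : ∃ ν, p ν ∧ ¬ p (ν + 2) := by
  by_contra! h
  obtain ⟨ν, hν⟩ := hp
  have hall (k : ℕ) : p (ν + 2 * k) := by
    induction k with
    | zero => simpa using hν
    | succ k ih =>
      have := h _ ih
      convert this using 1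
      push_cast
      ring
  obtain ⟨j, hj⟩ := hd _ hν
  obtain ⟨i, hi⟩ := hd _ (hall (j + 1))
  have : (i : ℂ) + 2 * (j + 1) = j := by
    push_cast at hi
    linear_combination hj - hi
  have : i + 2 * (j + 1) = j := by exact_mod_cast this
  omega

/-! ### The top weight space of the lowest component -/

/-- The submodule generated by a subspace `N` that is killed by the positive part and stable under
the zero part is obtained by applying the negative part. -/
theorem le_of_triangular (hirr : LieModule.IsIrreducible ℂ BabyTKK W) {N P : Submodule ℂ W}
    (hN : N ≠ ⊥) (hzero : ∀ u ∈ zeroGenerators, ∀ w ∈ N, ⁅u, w⁆ ∈ N)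
    (hpos : ∀ u ∈ posGenerators, ∀ w ∈ N, ⁅u, w⁆ = 0) (hNP : N ≤ P)
    (hP : ∀ u ∈ negGenerators, ∀ w ∈ P, ⁅u, w⁆ ∈ P) : P = ⊤ := by
  -- This replaces a Poincaré–Birkhoff–Witt argument. `Y` is the closure of `N` under the negative
  -- generators, and `Z` consists of the vectors of `Y` that the whole algebra sends into `Y`. By
  -- the Leibniz rule `Z` is again closed under the negative generators, so `Y ≤ Z` and `Y` is a
  -- submodule.
  let Y : Submodule ℂ W := sInf {Q | N ≤ Q ∧ ∀ u ∈ negGenerators, ∀ w ∈ Q, ⁅u, w⁆ ∈ Q}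
  have hNY : N ≤ Y := le_sInf fun Q hQ => hQ.1
  have hYneg : ∀ u ∈ negGenerators, ∀ w ∈ Y, ⁅u, w⁆ ∈ Y := by
    intro u hu w hw
    rw [Submodule.mem_sInf] at hw ⊢
    exact fun Q hQ => hQ.2 u hu w (hw Q hQ)
  let Z : Submodule ℂ W :=
    { carrier := {w | w ∈ Y ∧ ∀ b : BabyTKK, ⁅b, w⁆ ∈ Y}
      zero_mem' := ⟨Y.zero_mem, fun b => by rw [lie_zero]; exact Y.zero_mem⟩
      add_mem' := fun h h' =>
        ⟨Y.add_mem h.1 h'.1, fun b => by rw [lie_add]; exact Y.add_mem (h.2 b) (h'.2 b)⟩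
      smul_mem' := fun c _ h =>
        ⟨Y.smul_mem c h.1, fun b => by rw [lie_smul]; exact Y.smul_mem c (h.2 b)⟩ }
  have hYZ : Y ≤ Z := by
    refine sInf_le ⟨fun w hw => ⟨hNY hw, ?_⟩, fun a ha w hw => ⟨hYneg a ha w hw.1, fun b => ?_⟩⟩
    · refine lie_mem_of_span_eq_top span_triangular ?_
      rintro u ((hu | hu) | hu)
      · exact hYneg u hu w (hNY hw)
      · exact hNY (hzero u hu w hw)
      · rw [hpos u hu w hw]; exact Y.zero_mem
    · rw [leibniz_lie]
      exact Y.add_mem (hw.2 _) (hYneg a ha _ (hw.2 b))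
  have hY : Y = ⊤ := eq_top_of_lie_mem hirr (fun h => hN (le_bot_iff.mp (h ▸ hNY)))
    fun u w hw => (hYZ hw).2 u
  exact top_le_iff.mp (hY ▸ sInf_le ⟨hNP, hP⟩)

theorem lie_mem_weight (hgr : IsNGrading gr) {u : BabyTKK} (hu : u ∈ degreePart 0) {b ν : ℂ}
    (hb : ⁅coroot 0, u⁆ = b • u) {w : W} (hw : w ∈ gr n₀ ⊓ actEigenspace W (coroot 0) ν) :
    ⁅u, w⁆ ∈ gr n₀ ⊓ actEigenspace W (coroot 0) (ν + b) :=
  ⟨lie_mem_of_degree_zero hgr hu hw.1, lie_mem_actEigenspace hb hw.2⟩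

theorem xPos_zero_mem_degreePart (n : ℤ) : xPos (0, n) ∈ degreePart 0 := by
  simpa using xPos_mem_degreePart (0, n)

theorem xNeg_zero_mem_degreePart (n : ℤ) : xNeg (0, n) ∈ degreePart 0 := by
  simpa using xNeg_mem_degreePart (0, n)

/-- The top weight space of the lowest component is irreducible under the zero part. -/
theorem top_weight_space_irreducible (hirr : LieModule.IsIrreducible ℂ BabyTKK W)
    (hgr : IsNGrading gr) (hlow : ∀ n < n₀, gr n = ⊥) {ν : ℂ}
    (htop : gr n₀ ⊓ actEigenspace W (coroot 0) (ν + 2) = ⊥) {N : Submodule ℂ W}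
    (hN : N ≤ gr n₀ ⊓ actEigenspace W (coroot 0) ν) (hN0 : N ≠ ⊥)
    (hzero : ∀ u ∈ zeroGenerators, ∀ w ∈ N, ⁅u, w⁆ ∈ N) :
    N = gr n₀ ⊓ actEigenspace W (coroot 0) ν := by
  -- `K₁` collects the weights strictly below `ν` in the lowest component (the shift `j + 1`
  -- excludes `ν` itself), `K₂` the other degrees. `N ⊔ K₁ ⊔ K₂` is stable under the negative
  -- generators, hence is `W`; comparing degree and weight leaves only `N`.
  let K₁ : Submodule ℂ W := ⨆ j : ℕ, gr n₀ ⊓ actEigenspace W (coroot 0) (ν - 2 * (j + 1 : ℂ))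
  let K₂ : Submodule ℂ W := ⨆ n : ℕ, ⨆ _ : n ≠ n₀, gr n
  have hK₁T : K₁ ≤ gr n₀ := iSup_le fun j => inf_le_left
  have hgrK₂ {n : ℕ} (hn : n ≠ n₀) : gr n ≤ K₂ := le_iSup₂_of_le n hn le_rfl
  have hraise {k : ℤ} (hk : 0 < k) {u : BabyTKK} (hu : u ∈ degreePart k) {w : W}
      (hw : w ∈ gr n₀) : ⁅u, w⁆ ∈ K₂ := by
    obtain ⟨m, rfl⟩ := Int.eq_ofNat_of_zero_le hk.le
    exact hgrK₂ (n := n₀ + m) (by omega) (hgr.lie_mem _ n₀ (n₀ + m) (by push_cast; rfl) u hu w hw)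
  -- The components below `n₀` are zero, so raising the degree within `K₂` never lands in degree
  -- `n₀`.
  have hK₂ {k : ℤ} (hk : 0 ≤ k) {u : BabyTKK} (hu : u ∈ degreePart k) {w : W}
      (hw : w ∈ K₂) : ⁅u, w⁆ ∈ K₂ := by
    have : K₂ ≤ K₂.comap (LieModule.toEnd ℂ BabyTKK W u) := by
      refine iSup₂_le fun n hn w hw => ?_
      obtain ⟨m, rfl⟩ := Int.eq_ofNat_of_zero_le hk
      rcases lt_or_gt_of_ne hn with h | h
      · rw [hlow n h, Submodule.mem_bot] at hw
        rw [hw]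
        exact Submodule.zero_mem _
      · exact hgrK₂ (n := n + m) (by omega) (hgr.lie_mem _ n (n + m) (by push_cast; rfl) u hu w hw)
    exact this hw
  have hall : N ⊔ K₁ ⊔ K₂ = ⊤ := by
    refine le_of_triangular hirr hN0 hzero ?_ (le_sup_left.trans le_sup_left) ?_
    · rintro u (⟨k, hk, hu⟩ | ⟨n, rfl⟩) w hw
      · exact lie_eq_zero_of_lowest hgr hlow hk hu (hN hw).1
      · have := lie_mem_weight hgr (xPos_zero_mem_degreePart n) (lie_coroot_zero_xPos _) (hN hw)
        rwa [htop, Submodule.mem_bot] at this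
    · intro u hu w hw
      obtain ⟨w', hw', k₂, hk₂, rfl⟩ := Submodule.mem_sup.mp hw
      obtain ⟨x, hx, k₁, hk₁, rfl⟩ := Submodule.mem_sup.mp hw'
      rw [lie_add, lie_add]
      rcases hu with ⟨k, hk, hu⟩ | ⟨n, rfl⟩
      · exact Submodule.mem_sup_right (K₂.add_mem (K₂.add_mem (hraise hk hu (hN hx).1)
          (hraise hk hu (hK₁T hk₁))) (hK₂ hk.le hu hk₂))
      · have hn := xNeg_zero_mem_degreePart n
        refine Submodule.add_mem _ (Submodule.mem_sup_left (Submodule.mem_sup_right ?_))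
          (Submodule.mem_sup_right (hK₂ le_rfl hn hk₂))
        refine K₁.add_mem ?_ ?_
        · refine Submodule.mem_iSup_of_mem 0 ?_
          have := lie_mem_weight hgr hn (lie_coroot_zero_xNeg _) (hN hx)
          convert this using 3
          push_cast
          ring
        · have : K₁ ≤ K₁.comap (LieModule.toEnd ℂ BabyTKK W (xNeg (0, n))) := by
            refine iSup_le fun j w hw => Submodule.mem_iSup_of_mem (j + 1) ?_
            have := lie_mem_weight hgr hn (lie_coroot_zero_xNeg _) hw
            rw [LieModule.toEnd_apply_apply]
            convert this using 3
            push_cast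
            ring
          exact this hk₁
  refine le_antisymm hN fun w hw => ?_
  obtain ⟨w', hw', k₂, hk₂, hsum⟩ := Submodule.mem_sup.mp (hall.ge (Submodule.mem_top (x := w)))
  obtain ⟨x, hx, k₁, hk₁, rfl⟩ := Submodule.mem_sup.mp hw'
  -- Independence of the graded components removes `k₂`; independence of the eigenspaces of `α^∨`
  -- then removes `k₁`.
  have h2 : k₂ = 0 := by
    refine Submodule.disjoint_def.mp (hgr.isInternal.submodule_iSupIndep n₀) k₂ ?_ hk₂
    rw [show k₂ = w - x - k₁ by rw [← hsum]; abel]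
    exact Submodule.sub_mem _ (Submodule.sub_mem _ hw.1 (hN hx).1) (hK₁T hk₁)
  have h1 : k₁ = 0 := by
    refine Submodule.disjoint_def.mp
      ((LieModule.toEnd ℂ BabyTKK W (coroot 0)).eigenspaces_iSupIndep ν) k₁ ?_ ?_
    · rw [show k₁ = w - x by rw [← hsum, h2]; abel]
      exact Submodule.sub_mem _ hw.2 (hN hx).2
    · have : K₁ ≤ ⨆ c : ℂ, ⨆ _ : c ≠ ν,
          Module.End.eigenspace (LieModule.toEnd ℂ BabyTKK W (coroot 0)) c := by
        refine iSup_le fun j => inf_le_right.trans (le_iSup₂_of_le _ ?_ le_rfl)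
        rw [Ne, sub_eq_self, mul_eq_zero, not_or]
        exact ⟨two_ne_zero, by exact_mod_cast Nat.succ_ne_zero j⟩
      exact this hk₁
  rw [← hsum, h1, h2, add_zero, add_zero]
  exact hx

/-- The top weight space of the lowest component is spanned by any of its nonzero vectors. -/
theorem top_weight_space_eq_span (hirr : LieModule.IsIrreducible ℂ BabyTKK W)
    (hgr : IsNGrading gr) (hlow : ∀ n < n₀, gr n = ⊥) (hC : ∀ w : W, ⁅C₂ 0, w⁆ = 0) {ν : ℂ}
    (htop : gr n₀ ⊓ actEigenspace W (coroot 0) (ν + 2) = ⊥) {v : W}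
    (hv : v ∈ gr n₀ ⊓ actEigenspace W (coroot 0) ν) (hv0 : v ≠ 0) :
    Submodule.span ℂ {v} = gr n₀ ⊓ actEigenspace W (coroot 0) ν := by
  -- Brackets of zero generators are multiples of `C₂`, which acts by zero: this gives both
  -- stability of the weight space and commutativity. Once the generators act by scalars, every line
  -- is stable, so irreducibility leaves a single line.
  have hscal := exists_eq_smul_of_commuting_irreducible
    (gr n₀ ⊓ actEigenspace W (coroot 0) ν) ((Submodule.ne_bot_iff _).mpr ⟨v, hv, hv0⟩)
    (rank_le_aleph0_of_isIrreducible hirr) (LieModule.toEnd ℂ BabyTKK W '' zeroGenerators)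
    (by
      rintro _ ⟨u, hu, rfl⟩ w hw
      refine ⟨lie_mem_of_degree_zero hgr (zeroGenerators_subset_degreePart hu) hw.1, ?_⟩
      obtain ⟨z, hz⟩ := lie_zeroGenerators coroot_zero_mem_zeroGenerators hu
      have hw2 := mem_actEigenspace.mp hw.2
      refine mem_actEigenspace.mpr ?_
      rw [LieModule.toEnd_apply_apply, leibniz_lie, hz, smul_lie, hC, hw2]
      simp)
    (by
      rintro _ ⟨u, hu, rfl⟩ _ ⟨u', hu', rfl⟩ w -
      obtain ⟨z, hz⟩ := lie_zeroGenerators hu hu'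
      simp only [LieModule.toEnd_apply_apply]
      rw [leibniz_lie, hz, smul_lie, hC, smul_zero, zero_add])
    (fun N hN hN0 hst => top_weight_space_irreducible hirr hgr hlow htop hN hN0
      fun u hu w hw => hst _ (Set.mem_image_of_mem _ hu) w hw)
  refine top_weight_space_irreducible hirr hgr hlow htop
    ((Submodule.span_singleton_le_iff_mem _ _).mpr hv) (by simpa using hv0) ?_
  intro u hu w hw
  obtain ⟨z, hz⟩ := hscal _ (Set.mem_image_of_mem _ hu)
  obtain ⟨c, rfl⟩ := Submodule.mem_span_singleton.mp hw
  have := hz v hv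
  rw [LieModule.toEnd_apply_apply] at this
  rw [lie_smul, this]
  exact Submodule.smul_mem _ _ (Submodule.smul_mem _ _ (Submodule.mem_span_singleton_self v))

theorem lie_coroot_of_mem_rootSpace {β : ℤ × ℤ × ℤ} {u : BabyTKK} (hu : u ∈ rootSpace β) :
    ⁅coroot 0, u⁆ = (2 * (β.1 : ℂ)) • u :=
  Module.End.mem_eigenspace_iff.mp hu.1.1.1.1

theorem mem_degreePart_of_mem_rootSpace {β : ℤ × ℤ × ℤ} {u : BabyTKK} (hu : u ∈ rootSpace β) :
    u ∈ degreePart (-β.2.1) := by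
  have := Module.End.mem_eigenspace_iff.mp hu.1.2
  rw [degreePart, Module.End.mem_eigenspace_iff, this]
  simp

end IrreducibleModules

end TKK

end

/-! ### The highest weight vector -/

open TKK in
theorem proposition5p5 {W : Type*} [AddCommGroup W] [Module ℂ W] [LieRingModule BabyTKK W]
    [LieModule ℂ BabyTKK W] (hirr : LieModule.IsIrreducible ℂ BabyTKK W)
    (gr : ℕ → Submodule ℂ W) (hgr : IsNGrading gr)
    (hint : IsIntegrable W) (hres : IsRestricted W) :
    ∃ v : W, v ≠ 0 ∧ ∃ wt : Module.Dual ℂ zeroPart,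
      (∀ x ∈ posPart, ⁅x, v⁆ = 0) ∧
      wt ⟨C₂ 0, C₂_mem_zeroPart⟩ = 0 ∧
      ∀ h : zeroPart, ⁅(h : BabyTKK), v⁆ = wt h • v := by
  have := LieModule.nontrivial_of_isIrreducible ℂ BabyTKK W
  obtain ⟨n₀, hne, hlow⟩ := exists_lowest_component hgr
  obtain ⟨hC, hex, d, hd⟩ := level_eq_zero_and_weights_bounded hirr hgr hint hne hlow
  obtain ⟨ν, hν, htop⟩ := exists_top_weight hex d hd
  rw [not_not] at htop
  obtain ⟨v, hv, hv0⟩ := Submodule.exists_mem_ne_zero_of_ne_bot hν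
  have hspan := top_weight_space_eq_span hirr hgr hlow hC htop hv hv0
  let act : BabyTKK →ₗ[ℂ] W :=
    { toFun := fun u => ⁅u, v⁆
      map_add' := fun u u' => add_lie u u' v
      map_smul' := fun c u => smul_lie c u v }
  have hact (u : BabyTKK) : act u = ⁅u, v⁆ := rfl
  -- Since `φ v = 1`, the eigenvalue of an operator with eigenvector `v` is `φ` of the image of `v`;
  -- this makes the weight linear by construction.
  obtain ⟨φ, hφ⟩ := Module.Projective.exists_dual_eq_one ℂ hv0
  refine ⟨v, hv0, φ ∘ₗ act ∘ₗ zeroPart.subtype, ?_, ?_, ?_⟩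
  · have : posPart ≤ LinearMap.ker act := by
      refine iSup₂_le fun β hβ u hu => ?_
      rw [LinearMap.mem_ker, hact]
      have hdeg := mem_degreePart_of_mem_rootSpace hu
      -- A root `α + nδ₂` sends `v` into the weight space of `ν + 2`, which is zero; a positive
      -- `δ₁`-coefficient sends it below the lowest degree.
      rcases hβ.2 with ⟨h1, h2⟩ | h
      · have hc := lie_coroot_of_mem_rootSpace hu
        rw [h2, neg_zero] at hdeg
        rw [h1, Int.cast_one, mul_one] at hc
        have := lie_mem_weight hgr hdeg hc hv
        rwa [htop, Submodule.mem_bot] at this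
      · exact lie_eq_zero_of_lowest hgr hlow (neg_neg_of_pos h) hdeg hv.1
    exact fun x hx => this hx
  · change φ ⁅C₂ 0, v⁆ = 0
    rw [hC, map_zero]
  · rintro ⟨h, hh⟩
    -- Root vectors for `nδ₂` preserve degree and weight, hence the line through `v`; no spanning
    -- set of `ℋ` is needed.
    have : zeroPart ≤ (Submodule.span ℂ {v}).comap act := by
      refine iSup₂_le fun β hβ u hu => ?_
      have hdeg := mem_degreePart_of_mem_rootSpace hu
      have hc := lie_coroot_of_mem_rootSpace hu
      rw [hβ.2, neg_zero] at hdeg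
      rw [hβ.1, Int.cast_zero, mul_zero] at hc
      have := lie_mem_weight hgr hdeg hc hv
      rwa [add_zero, ← hspan] at this
    obtain ⟨c, hc⟩ := Submodule.mem_span_singleton.mp (this hh)
    change ⁅h, v⁆ = φ (act h) • v
    rw [← hc, map_smul, hφ, smul_eq_mul, mul_one, hc, hact]
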